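/- Let $(M,g,J)$ be a Kähler manifold of indefinite metric, of real dimension $2n$ and signature $(2s,2(n-s))$ ($2s$ minus signs, $2(n-s)$ plus signs): $g$ is a smooth pseudo-Riemannian metric of this signature, $J$ is a smooth almost complex structure with $J^2=-\mathrm{id}$, $g(JX,JY)=g(X,Y)$, and $\nabla J=0$ for the Levi-Civita connection $\nabla$ of $g$. Assume $s\ge 2$ and $n-s\ge 2$. A 2-dimensional subspace $E\subset T_pM$ is called an isotropic holomorphic 2-plane if $JE=E$ and the restriction of $g$ to $E$ is degenerate (it is then identically zero). Suppose that $M$ satisfies the axiom of isotropic holomorphic 2-planes: for each point $p\in M$ and each isotropic holomorphic 2-plane $E\subset T_pM$ there is a totally geodesic submanifold $M'$ of $M$ containing $p$ such that $T_pM'=E$ and all the tangent spaces of $M'$ are isotropic holomorphic 2-planes. (Totally geodesic means that $\nabla_XY$ is tangent to $M'$ whenever $X,Y$ are tangent to $M'$.) Then the Bochner curvature tensor $B(R)$ of $M$ vanishes identically. Here $R(x,y,z,u)=g(R(x,y)z,u)$ with $R(X,Y)=[\nabla_X,\nabla_Y]-\nabla_{[X,Y]}$, and for a tensor $T$ of type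 $(0,4)$ and an orthonormal basis $\{e_i\}$ of $T_pM$ one puts $\overline T(x,y,z,u)=T(Jx,Jy,Jz,Ju)$, $$\rho(T)(y,z)=\sum_i g(e_i,e_i)T(e_i,y,z,e_i),\qquad \rho^*(T)(y,z)=\sum_i g(e_i,e_i)T(e_i,y,Jz,Je_i),$$ $\tau(T)=\sum_i g(e_i,e_i)\rho(T)(e_i,e_i)$, $\tau^*(T)=\sum_i g(e_i,e_i)\rho^*(T)(e_i,e_i)$. For a tensor $S$ of type $(0,2)$, $$\varphi(S)(x,y,z,u)=g(y,z)S(x,u)-g(x,z)S(y,u)+g(x,u)S(y,z)-g(y,u)S(x,z),$$ $$\psi(S)(x,y,z,u)=g(y,Jz)S(x,Ju)-g(x,Jz)S(y,Ju)-2g(x,Jy)S(z,Ju)+g(x,Ju)S(y,Jz)-g(y,Ju)S(x,Jz)-2g(z,Ju)S(x,Jy),$$ $\pi_1=\tfrac12\varphi(g)$, $\pi_2=\tfrac12\psi(g)$, and $$B(R)=R-\frac{(\varphi+\psi)\big((\rho+3\rho^*)(R+\overline R)\big)}{16(n+2)}-\frac{(3\varphi-\psi)\big((\rho-\rho^*)(R+\overline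 R)\big)}{16(n-2)}-\frac{\psi\big(\rho^*(R-\overline R)\big)}{4(n+1)}-\frac{\varphi\big(\rho(R-\overline R)\big)}{4(n-1)}$$ $$+\frac{(\tau+3\tau^*)(R)}{16(n+1)(n+2)}(\pi_1+\pi_2)+\frac{(\tau-\tau^*)(R)}{16(n-1)(n-2)}(3\pi_1-\pi_2).$$ -/

import Mathlib

open scoped Manifold ContDiff Topology
open Bundle

noncomputable section

/-! ### Pseudo-Riemannian and almost Hermitian structures

`M` is a smooth manifold without boundary modelled on the real vector space `E`, and a vector field
is a function `X : Π q : M, TangentSpace 𝓘(ℝ, E) q`. -/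

namespace IndefKaehler

section Fields

variable {E : Type*} [NormedAddCommGroup E] [NormedSpace ℝ E]
  {M : Type*} [TopologicalSpace M] [ChartedSpace E M] [IsManifold 𝓘(ℝ, E) ∞ M]

/-- The vector field `X` is of class `C^∞` at `x`. -/
def SmoothFieldAt (X : Π q : M, TangentSpace 𝓘(ℝ, E) q) (x : M) : Prop :=
  ContMDiffAt 𝓘(ℝ, E) (𝓘(ℝ, E).prod 𝓘(ℝ, E)) ∞
    (fun q ↦ (TotalSpace.mk' E q (X q) : TangentBundle 𝓘(ℝ, E) M)) x

/-- The vector field `X` is differentiable at `x`. -/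
def DiffFieldAt (X : Π q : M, TangentSpace 𝓘(ℝ, E) q) (x : M) : Prop :=
  MDifferentiableAt 𝓘(ℝ, E) (𝓘(ℝ, E).prod 𝓘(ℝ, E))
    (fun q ↦ (TotalSpace.mk' E q (X q) : TangentBundle 𝓘(ℝ, E) M)) x

end Fields

section Structures

variable (E : Type*) [NormedAddCommGroup E] [NormedSpace ℝ E]
  (M : Type*) [TopologicalSpace M] [ChartedSpace E M] [IsManifold 𝓘(ℝ, E) ∞ M]

/-- A pseudo-Riemannian metric: a smooth field of nondegenerate symmetric bilinear forms on the
tangent spaces. -/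
structure PseudoMetric where
  /-- the bilinear form on each tangent space -/
  form (p : M) : TangentSpace 𝓘(ℝ, E) p →L[ℝ] TangentSpace 𝓘(ℝ, E) p →L[ℝ] ℝ
  symm (p : M) (v w : TangentSpace 𝓘(ℝ, E) p) : form p v w = form p w v
  nondegenerate (p : M) (v : TangentSpace 𝓘(ℝ, E) p) (hv : ∀ w, form p v w = 0) : v = 0
  contMDiff : ContMDiff 𝓘(ℝ, E) (𝓘(ℝ, E).prod 𝓘(ℝ, E →L[ℝ] E →L[ℝ] ℝ)) ∞
    (fun p ↦ TotalSpace.mk' (E →L[ℝ] E →L[ℝ] ℝ)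
      (E := fun q : M ↦ TangentSpace 𝓘(ℝ, E) q →L[ℝ] TangentSpace 𝓘(ℝ, E) q →L[ℝ] ℝ) p (form p))

/-- An almost Hermitian structure `(g, J)`, the metric `g` being allowed to be indefinite: `J` is a
smooth field of endomorphisms of the tangent spaces with `J² = -1` and `g(Jv, Jw) = g(v, w)`. -/
structure AlmostHermitian where
  /-- the metric -/
  g : PseudoMetric E M
  /-- the almost complex structure -/
  J (p : M) : TangentSpace 𝓘(ℝ, E) p →L[ℝ] TangentSpace 𝓘(ℝ, E) p
  J_sq (p : M) (v : TangentSpace 𝓘(ℝ, E) p) : J p (J p v) = -v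
  compat (p : M) (v w : TangentSpace 𝓘(ℝ, E) p) : g.form p (J p v) (J p w) = g.form p v w
  contMDiff_J : ContMDiff 𝓘(ℝ, E) (𝓘(ℝ, E).prod 𝓘(ℝ, E →L[ℝ] E)) ∞
    (fun p ↦ TotalSpace.mk' (E →L[ℝ] E)
      (E := fun q : M ↦ TangentSpace 𝓘(ℝ, E) q →L[ℝ] TangentSpace 𝓘(ℝ, E) q) p (J p))

end Structures

variable {E : Type*} [NormedAddCommGroup E] [NormedSpace ℝ E]
  {M : Type*} [TopologicalSpace M] [ChartedSpace E M] [IsManifold 𝓘(ℝ, E) ∞ M]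

/-- The basis `e` of `T_pM` is orthonormal: `g(e_i, e_i) = ±1` and `g(e_i, e_j) = 0` for
`i ≠ j`. -/
def PseudoMetric.IsOrthonormalBasis (g : PseudoMetric E M) (p : M) {ι : Type*}
    (e : Module.Basis ι ℝ (TangentSpace 𝓘(ℝ, E) p)) : Prop :=
  (∀ i, g.form p (e i) (e i) = 1 ∨ g.form p (e i) (e i) = -1) ∧
    ∀ i j, i ≠ j → g.form p (e i) (e j) = 0

/-- `g` has signature `(a, b)`: each tangent space has an orthonormal basis consisting of `a`
vectors with `g(e, e) = -1` and `b` vectors with `g(e, e) = 1`. -/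
def PseudoMetric.HasSignature (g : PseudoMetric E M) (a b : ℕ) : Prop :=
  ∀ p : M, ∃ e : Module.Basis (Fin a ⊕ Fin b) ℝ (TangentSpace 𝓘(ℝ, E) p),
    g.IsOrthonormalBasis p e ∧
    (∀ i, g.form p (e (Sum.inl i)) (e (Sum.inl i)) = -1) ∧
    ∀ j, g.form p (e (Sum.inr j)) (e (Sum.inr j)) = 1

/-! ### Levi-Civita connection, Kähler condition, curvature

For a covariant derivative `nabla` on the tangent bundle, `nabla Y x v` is `(∇_v Y)(x)`. -/

/-- `nabla` is the Levi-Civita connection of `g`: the smooth linear connection that is torsion-free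
and satisfies `∇g = 0`. -/
structure IsLeviCivita (g : PseudoMetric E M)
    (nabla : CovariantDerivative 𝓘(ℝ, E) E (TangentSpace 𝓘(ℝ, E) : M → Type _)) : Prop where
  smooth (U : Set M) (hU : IsOpen U) : ContMDiffCovariantDerivativeOn E ∞ nabla U
  torsion_free (X Y : Π q : M, TangentSpace 𝓘(ℝ, E) q) (x : M)
    (hX : DiffFieldAt X x) (hY : DiffFieldAt Y x) :
    nabla Y x (X x) - nabla X x (Y x) = VectorField.mlieBracket 𝓘(ℝ, E) X Y x
  metric (Y Z : Π q : M, TangentSpace 𝓘(ℝ, E) q) (x : M)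
    (hY : DiffFieldAt Y x) (hZ : DiffFieldAt Z x) (v : TangentSpace 𝓘(ℝ, E) x) :
    mvfderiv 𝓘(ℝ, E) (fun q ↦ g.form q (Y q) (Z q)) x v =
      g.form x (nabla Y x v) (Z x) + g.form x (Y x) (nabla Z x v)

/-- `(M, g, J)` is a Kähler manifold with Levi-Civita connection `nabla`: `∇J = 0`, that is,
`∇_v(JY) = J ∇_v Y`. -/
structure IsKaehler (h : AlmostHermitian E M)
    (nabla : CovariantDerivative 𝓘(ℝ, E) E (TangentSpace 𝓘(ℝ, E) : M → Type _)) : Prop where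
  leviCivita : IsLeviCivita h.g nabla
  parallel_J (Y : Π q : M, TangentSpace 𝓘(ℝ, E) q) (x : M) (hY : DiffFieldAt Y x)
    (v : TangentSpace 𝓘(ℝ, E) x) :
    nabla (fun q ↦ h.J q (Y q)) x v = h.J x (nabla Y x v)

/-- The curvature operator `R(x, y)z = (∇_X ∇_Y Z - ∇_Y ∇_X Z - ∇_{[X, Y]} Z)(p)`, where `X`, `Y`,
`Z` are the vector fields with values `x`, `y`, `z` at `p` that have constant coordinates in the
preferred trivialization of the tangent bundle at `p`; they are smooth near `p`. -/
def curvature (nabla : CovariantDerivative 𝓘(ℝ, E) E (TangentSpace 𝓘(ℝ, E) : M → Type _)) (p : M)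
    (x y z : TangentSpace 𝓘(ℝ, E) p) : TangentSpace 𝓘(ℝ, E) p :=
  let X : Π q : M, TangentSpace 𝓘(ℝ, E) q := FiberBundle.extend E x
  let Y : Π q : M, TangentSpace 𝓘(ℝ, E) q := FiberBundle.extend E y
  let Z : Π q : M, TangentSpace 𝓘(ℝ, E) q := FiberBundle.extend E z
  nabla (fun q ↦ nabla Z q (Y q)) p x - nabla (fun q ↦ nabla Z q (X q)) p y
    - nabla Z p (VectorField.mlieBracket 𝓘(ℝ, E) X Y p)

/-- The curvature tensor of type (0,4), `R(x, y, z, u) = g(R(x, y)z, u)`. -/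
def curvatureTensor (g : PseudoMetric E M)
    (nabla : CovariantDerivative 𝓘(ℝ, E) E (TangentSpace 𝓘(ℝ, E) : M → Type _)) (p : M)
    (x y z u : TangentSpace 𝓘(ℝ, E) p) : ℝ :=
  g.form p (curvature nabla p x y z) u

/-! ### The Bochner tensor

Pointwise algebra on a real vector space `V` with a bilinear form `g` and an endomorphism `J`.
Traces are taken with respect to an orthonormal basis `e`. -/

section Bochner

variable {V : Type*} [AddCommGroup V] [Module ℝ V] {ι : Type*} [Fintype ι]

/-- `ρ(T)(y, z) = ∑ g(e_i, e_i) T(e_i, y, z, e_i)` -/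
def ricci (g : V → V → ℝ) (e : Module.Basis ι ℝ V) (T : V → V → V → V → ℝ) (y z : V) : ℝ :=
  ∑ i, g (e i) (e i) * T (e i) y z (e i)

/-- `ρ*(T)(y, z) = ∑ g(e_i, e_i) T(e_i, y, Jz, Je_i)` -/
def ricciStar (g : V → V → ℝ) (J : V → V) (e : Module.Basis ι ℝ V) (T : V → V → V → V → ℝ)
    (y z : V) : ℝ :=
  ∑ i, g (e i) (e i) * T (e i) y (J z) (J (e i))

/-- The trace `∑ g(e_i, e_i) S(e_i, e_i)`; it gives `τ` from `ρ` and `τ*` from `ρ*`. -/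
def trace (g : V → V → ℝ) (e : Module.Basis ι ℝ V) (S : V → V → ℝ) : ℝ :=
  ∑ i, g (e i) (e i) * S (e i) (e i)

/-- The tensor `φ(S)`. -/
def phi (g : V → V → ℝ) (S : V → V → ℝ) (x y z u : V) : ℝ :=
  g y z * S x u - g x z * S y u + g x u * S y z - g y u * S x z

/-- The tensor `ψ(S)`. -/
def psi (g : V → V → ℝ) (J : V → V) (S : V → V → ℝ) (x y z u : V) : ℝ :=
  g y (J z) * S x (J u) - g x (J z) * S y (J u) - 2 * g x (J y) * S z (J u)
    + g x (J u) * S y (J z) - g y (J u) * S x (J z) - 2 * g z (J u) * S x (J y)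

/-- The tensor `π₁`. -/
def pi₁ (g : V → V → ℝ) (x y z u : V) : ℝ :=
  g y z * g x u - g x z * g y u

/-- The tensor `π₂`. -/
def pi₂ (g : V → V → ℝ) (J : V → V) (x y z u : V) : ℝ :=
  g y (J z) * g x (J u) - g x (J z) * g y (J u) - 2 * g x (J y) * g z (J u)

/-- The Bochner tensor `B(R)` of a curvature tensor `R` in complex dimension `n`, for an arbitrary
almost Hermitian structure; `Rbar(x, y, z, u) = R(Jx, Jy, Jz, Ju)`. -/
def bochner (n : ℕ) (g : V → V → ℝ) (J : V → V) (e : Module.Basis ι ℝ V)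
    (R : V → V → V → V → ℝ) (x y z u : V) : ℝ :=
  let Rbar : V → V → V → V → ℝ := fun x y z u ↦ R (J x) (J y) (J z) (J u)
  let P : V → V → V → V → ℝ := fun x y z u ↦ R x y z u + Rbar x y z u
  let Q : V → V → V → V → ℝ := fun x y z u ↦ R x y z u - Rbar x y z u
  let S₁ : V → V → ℝ := fun y z ↦ ricci g e P y z + 3 * ricciStar g J e P y z
  let S₂ : V → V → ℝ := fun y z ↦ ricci g e P y z - ricciStar g J e P y z
  let τ : ℝ := trace g e (ricci g e R)
  let τs : ℝ := trace g e (ricciStar g J e R)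
  R x y z u
    - 1 / (16 * ((n : ℝ) + 2)) * (phi g S₁ x y z u + psi g J S₁ x y z u)
    - 1 / (16 * ((n : ℝ) - 2)) * (3 * phi g S₂ x y z u - psi g J S₂ x y z u)
    - 1 / (4 * ((n : ℝ) + 1)) * psi g J (ricciStar g J e Q) x y z u
    - 1 / (4 * ((n : ℝ) - 1)) * phi g (ricci g e Q) x y z u
    + 1 / (16 * ((n : ℝ) + 1) * ((n : ℝ) + 2)) * (τ + 3 * τs)
        * (pi₁ g x y z u + pi₂ g J x y z u)
    + 1 / (16 * ((n : ℝ) - 1) * ((n : ℝ) - 2)) * (τ - τs)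
        * (3 * pi₁ g x y z u - pi₂ g J x y z u)

end Bochner

/-- The Bochner curvature tensor of `(M, g, J)`, of real dimension `2n`, vanishes. -/
def BochnerVanishes (n : ℕ) (h : AlmostHermitian E M)
    (nabla : CovariantDerivative 𝓘(ℝ, E) E (TangentSpace 𝓘(ℝ, E) : M → Type _)) : Prop :=
  ∀ (p : M) (e : Module.Basis (Fin (2 * n)) ℝ (TangentSpace 𝓘(ℝ, E) p)),
    h.g.IsOrthonormalBasis p e → ∀ x y z u : TangentSpace 𝓘(ℝ, E) p,
      bochner n (fun v w ↦ h.g.form p v w) (fun v ↦ h.J p v) e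
        (curvatureTensor h.g nabla p) x y z u = 0

/-! ### The axiom of isotropic holomorphic 2-planes -/

/-- `P` is an isotropic holomorphic 2-plane in `T_pM`: `dim P = 2`, `JP = P`, and the restriction of
`g` to `P` is degenerate (of rank 1 or 0). -/
def IsIsotropicHolomorphicPlane (h : AlmostHermitian E M) (p : M)
    (P : Submodule ℝ (TangentSpace 𝓘(ℝ, E) p)) : Prop :=
  Module.finrank ℝ P = 2 ∧ P.map (h.J p).toLinearMap = P ∧
    ∃ v ∈ P, v ≠ 0 ∧ ∀ w ∈ P, h.g.form p v w = 0

section Submanifolds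

variable {N : Type*} [TopologicalSpace N] [ChartedSpace (EuclideanSpace ℝ (Fin 2)) N]

/-- The tangent space at `f a` of the surface `f : N → M`, as a subspace of `T_{f a}M`. -/
def tangentPlane (f : N → M) (a : N) : Submodule ℝ (TangentSpace 𝓘(ℝ, E) (f a)) :=
  LinearMap.range (mfderiv (𝓡 2) 𝓘(ℝ, E) f a).toLinearMap

/-- The immersed surface `f : N → M` is totally geodesic: `∇_X Y` is tangent to it whenever the
local vector fields `X`, `Y` of `M` are tangent to it. -/
def IsTotallyGeodesic
    (nabla : CovariantDerivative 𝓘(ℝ, E) E (TangentSpace 𝓘(ℝ, E) : M → Type _)) (f : N → M) :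
    Prop :=
  ∀ (a : N) (X Y : Π q : M, TangentSpace 𝓘(ℝ, E) q),
    SmoothFieldAt X (f a) → SmoothFieldAt Y (f a) →
    (∀ᶠ b in 𝓝 a, X (f b) ∈ tangentPlane f b) → (∀ᶠ b in 𝓝 a, Y (f b) ∈ tangentPlane f b) →
    nabla Y (f a) (X (f a)) ∈ tangentPlane f a

end Submanifolds

/-- The axiom of isotropic holomorphic 2-planes: for each point `p` and each isotropic holomorphic
2-plane `P` in `T_pM` there is a totally geodesic (injectively immersed) submanifold through `p`
with tangent space `P` at `p`, all of whose tangent spaces are isotropic holomorphic 2-planes. -/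
def AxiomOfIsotropicHolomorphicPlanes (h : AlmostHermitian E M)
    (nabla : CovariantDerivative 𝓘(ℝ, E) E (TangentSpace 𝓘(ℝ, E) : M → Type _)) : Prop :=
  ∀ (p : M) (P : Submodule ℝ (TangentSpace 𝓘(ℝ, E) p)), IsIsotropicHolomorphicPlane h p P →
    ∃ (N : Type) (_ : TopologicalSpace N) (_ : ChartedSpace (EuclideanSpace ℝ (Fin 2)) N)
      (_ : IsManifold (𝓡 2) ∞ N) (f : N → M) (a : N) (ha : f a = p),
      Manifold.IsImmersion (𝓡 2) 𝓘(ℝ, E) ∞ f ∧ Function.Injective f ∧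
      ha ▸ tangentPlane f a = P ∧
      (∀ b, IsIsotropicHolomorphicPlane h (f b) (tangentPlane f b)) ∧
      IsTotallyGeodesic nabla f

end IndefKaehler

end

/-!
For isotropic `v` the plane spanned by `v` and `Jv` is isotropic and holomorphic, and the curvature
of `M` maps the tangent planes of a totally geodesic surface into themselves; hence the holomorphic
sectional curvature `H(v) = R(v, Jv, Jv, v)` vanishes on the quadric `g(v, v) = 0`. Since `g` is
indefinite, the quartic form `H` is then divisible by `g`: comparing `H` at the isotropic vectors
`± √g(w, w) e + w`, where `g(e, e) = -1` and `w ⟂ e`, gives `H(v) = g(v, v) S(v, v)` on an open set,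
hence everywhere, and averaging over `J` makes `S` Hermitian. The Kähler tensor `(φ + ψ)(S)` has
holomorphic sectional curvature `8 g(v, v) S(v, v)`, and a Kähler tensor is determined by its
holomorphic sectional curvature, so `R = (φ + ψ)(S / 8)`. Computing traces shows that the Bochner
tensor of any `(φ + ψ)(S)` vanishes.
-/

noncomputable section

namespace IndefKaehler

open VectorField

section SmoothFields

variable {E : Type*} [NormedAddCommGroup E] [NormedSpace ℝ E]
  {M : Type*} [TopologicalSpace M] [ChartedSpace E M] {f : M → ℝ} {p : M}

variable (E) in
/-- The function `f` is smooth on a neighbourhood of `p`, where `M` is modelled on `E`. -/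
def SmoothFunNear (f : M → ℝ) (p : M) : Prop :=
  ∀ᶠ q in 𝓝 p, ContMDiffAt 𝓘(ℝ, E) 𝓘(ℝ) ∞ f q

lemma SmoothFunNear.mdifferentiableAt (hf : SmoothFunNear E f p) :
    MDifferentiableAt 𝓘(ℝ, E) 𝓘(ℝ) f p :=
  hf.self_of_nhds.mdifferentiableAt (by simp)

lemma SmoothFunNear.eventually (hf : SmoothFunNear E f p) : ∀ᶠ q in 𝓝 p, SmoothFunNear E f q :=
  eventually_eventually_nhds.2 hf

variable [IsManifold 𝓘(ℝ, E) ∞ M]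

/-- The vector field `X` is smooth on a neighbourhood of `p`. Unlike differentiability at `p`, this
is inherited by covariant derivatives and Lie brackets. -/
def SmoothNear (X : Π q : M, TangentSpace 𝓘(ℝ, E) q) (p : M) : Prop :=
  ∀ᶠ q in 𝓝 p, SmoothFieldAt X q

/-- The covariant derivative of a smooth vector field is smooth; this is the part of `IsLeviCivita`
that does not refer to the metric. -/
def IsSmoothConnection
    (nabla : CovariantDerivative 𝓘(ℝ, E) E (TangentSpace 𝓘(ℝ, E) : M → Type _)) : Prop :=
  ∀ U : Set M, IsOpen U → ContMDiffCovariantDerivativeOn E ∞ nabla U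

variable {X Y Z : Π q : M, TangentSpace 𝓘(ℝ, E) q}
  {nabla : CovariantDerivative 𝓘(ℝ, E) E (TangentSpace 𝓘(ℝ, E) : M → Type _)}

lemma SmoothNear.smoothFieldAt (hX : SmoothNear X p) : SmoothFieldAt X p := hX.self_of_nhds

lemma SmoothNear.diffFieldAt (hX : SmoothNear X p) : DiffFieldAt X p :=
  ContMDiffAt.mdifferentiableAt hX.smoothFieldAt (by simp)

lemma SmoothNear.eventually (hX : SmoothNear X p) : ∀ᶠ q in 𝓝 p, SmoothNear X q :=
  eventually_eventually_nhds.2 hX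

lemma SmoothNear.smul (hf : SmoothFunNear E f p) (hX : SmoothNear X p) :
    SmoothNear (f • X) p := by
  filter_upwards [hf, hX] with q hfq hXq
  exact ContMDiffAt.smul_section hfq hXq

lemma SmoothNear.extend (v : TangentSpace 𝓘(ℝ, E) p) :
    SmoothNear (FiberBundle.extend E v) p := by
  obtain ⟨t, ht, h⟩ := FiberBundle.exists_contMDiffOn_extend (I := 𝓘(ℝ, E)) (k := ∞) E v
  filter_upwards [eventually_mem_nhds_iff.2 ht] with q hq
  exact h.contMDiffAt hq

protected lemma SmoothNear.mvfderiv (hf : SmoothFunNear E f p) (hX : SmoothNear X p) :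
    SmoothFunNear E (fun q ↦ mvfderiv 𝓘(ℝ, E) f q (X q)) p := by
  filter_upwards [hf, hX] with q hfq hXq
  have h := ContMDiffAt.clm_apply_of_inCoordinates (b₁ := id) (b₂ := f)
    (hfq.mfderiv_const (m := ∞) (by simp)) hXq hfq
  rw [contMDiffAt_totalSpace] at h
  simpa [mvfderiv] using! h.2

lemma SmoothNear.form (g : PseudoMetric E M) (hX : SmoothNear X p) (hY : SmoothNear Y p) :
    SmoothFunNear E (fun q ↦ g.form q (X q) (Y q)) p := by
  filter_upwards [hX, hY] with q hXq hYq
  have h := ContMDiffAt.clm_bundle_apply₂ (E₃ := fun _ : M ↦ ℝ) (F₃ := ℝ) (b := id)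
    (g.contMDiff q) hXq hYq
  simpa [contMDiffAt_section] using h

lemma SmoothNear.J (h : AlmostHermitian E M) (hX : SmoothNear X p) :
    SmoothNear (fun q ↦ h.J q (X q)) p := by
  filter_upwards [hX] with q hXq
  exact ContMDiffAt.clm_bundle_apply (b := id) (h.contMDiff_J q) hXq

lemma IsSmoothConnection.contMDiffAt (hn : IsSmoothConnection nabla) (hX : SmoothNear X p) :
    ContMDiffAt 𝓘(ℝ, E) (𝓘(ℝ, E).prod 𝓘(ℝ, E →L[ℝ] E)) ∞
      (fun q ↦ TotalSpace.mk' (E →L[ℝ] E)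
        (E := fun q : M ↦ TangentSpace 𝓘(ℝ, E) q →L[ℝ] TangentSpace 𝓘(ℝ, E) q) q
        (nabla X q)) p := by
  obtain ⟨U, hU, hUo, hpU⟩ := eventually_nhds_iff.1 hX
  exact ((hn U hUo).contMDiff fun q hq ↦ (hU q hq).contMDiffWithinAt).contMDiffAt
    (hUo.mem_nhds hpU)

lemma IsSmoothConnection.diffFieldAt (hn : IsSmoothConnection nabla) (hX : DiffFieldAt X p)
    (hY : SmoothNear Y p) : DiffFieldAt (fun q ↦ nabla Y q (X q)) p :=
  MDifferentiableAt.clm_bundle_apply (b := id)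
    ((hn.contMDiffAt hY).mdifferentiableAt (by simp)) hX

lemma SmoothNear.cov (hn : IsSmoothConnection nabla) (hX : SmoothNear X p)
    (hY : SmoothNear Y p) : SmoothNear (fun q ↦ nabla Y q (X q)) p := by
  filter_upwards [hX, hY.eventually] with q hXq hYq
  exact ContMDiffAt.clm_bundle_apply (b := id) (hn.contMDiffAt hYq) hXq

lemma DiffFieldAt.cov_congr (hY : DiffFieldAt Y p) (e : ∀ᶠ q in 𝓝 p, Z q = Y q) :
    nabla Z p = nabla Y p :=
  nabla.isCovariantDerivativeOnUniv.congr_of_eventuallyEq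
    (hY.congr_of_eventuallyEq (e.mono fun q hq ↦ by simp [hq])) hY Filter.univ_mem e

end SmoothFields

section Bracket

variable {E : Type*} [NormedAddCommGroup E] [NormedSpace ℝ E] [CompleteSpace E]
  {M : Type*} [TopologicalSpace M] [ChartedSpace E M] [IsManifold 𝓘(ℝ, E) ∞ M]
  {X Y Z : Π q : M, TangentSpace 𝓘(ℝ, E) q} {f : M → ℝ} {p : M}

protected lemma SmoothNear.mlieBracket (hX : SmoothNear X p) (hY : SmoothNear Y p) :
    SmoothNear (mlieBracket 𝓘(ℝ, E) X Y) p := by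
  filter_upwards [hX, hY] with q hXq hYq
  have : IsManifold 𝓘(ℝ, E) ((⊤ : ℕ∞) + 1) M := ‹_›
  have : IsManifold 𝓘(ℝ, E) (minSmoothness ℝ 2) M := by
    rw [minSmoothness_of_isRCLikeNormedField]; infer_instance
  exact ContMDiffAt.mlieBracket_vectorField (m := ⊤) (n := ⊤) hXq hYq (by simp)

lemma SmoothNear.jacobi (hX : SmoothNear X p) (hY : SmoothNear Y p) (hZ : SmoothNear Z p) :
    mlieBracket 𝓘(ℝ, E) X (mlieBracket 𝓘(ℝ, E) Y Z) p =
      mlieBracket 𝓘(ℝ, E) (mlieBracket 𝓘(ℝ, E) X Y) Z p +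
        mlieBracket 𝓘(ℝ, E) Y (mlieBracket 𝓘(ℝ, E) X Z) p := by
  have : IsManifold 𝓘(ℝ, E) (minSmoothness ℝ 3) M := by
    rw [minSmoothness_of_isRCLikeNormedField]; infer_instance
  have smooth {W : Π q : M, TangentSpace 𝓘(ℝ, E) q} (hW : SmoothNear W p) :
      ContMDiffAt 𝓘(ℝ, E) (𝓘(ℝ, E).prod 𝓘(ℝ, E)) (minSmoothness ℝ 2)
        (fun q ↦ (TotalSpace.mk' E q (W q) : TangentBundle 𝓘(ℝ, E) M)) p :=
    ContMDiffAt.of_le hW.smoothFieldAt (by simpa using ENat.LEInfty.out (m := 2))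
  exact leibniz_identity_mlieBracket_apply (smooth hX) (smooth hY) (smooth hZ)

lemma SmoothNear.mlieBracket_mlieBracket_smul (X : Π q : M, TangentSpace 𝓘(ℝ, E) q)
    (hY : SmoothNear Y p) (hf : SmoothFunNear E f p) (hZ : SmoothNear Z p) :
    mlieBracket 𝓘(ℝ, E) X (mlieBracket 𝓘(ℝ, E) Y (f • Z)) p =
      mvfderiv 𝓘(ℝ, E) (fun q ↦ mvfderiv 𝓘(ℝ, E) f q (Y q)) p (X p) • Z p
        + mvfderiv 𝓘(ℝ, E) f p (Y p) • mlieBracket 𝓘(ℝ, E) X Z p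
        + mvfderiv 𝓘(ℝ, E) f p (X p) • mlieBracket 𝓘(ℝ, E) Y Z p
        + f p • mlieBracket 𝓘(ℝ, E) X (mlieBracket 𝓘(ℝ, E) Y Z) p := by
  have leibniz : ∀ᶠ q in 𝓝 p, mlieBracket 𝓘(ℝ, E) Y (f • Z) q =
      ((fun q ↦ mvfderiv 𝓘(ℝ, E) f q (Y q)) • Z + f • mlieBracket 𝓘(ℝ, E) Y Z) q := by
    filter_upwards [hf.eventually, hZ.eventually] with q hfq hZq
    exact mlieBracket_smul_right hfq.mdifferentiableAt hZq.diffFieldAt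
  have hYf := (hY.mvfderiv hf).mdifferentiableAt
  have hYZ := (hY.mlieBracket hZ).diffFieldAt
  have hfd := hf.mdifferentiableAt
  rw [Filter.EventuallyEq.mlieBracket_vectorField_eq (V₁ := X) (V := X) .rfl leibniz,
    mlieBracket_add_right (hYf.smul_section hZ.diffFieldAt) (hfd.smul_section hYZ),
    mlieBracket_smul_right hYf hZ.diffFieldAt, mlieBracket_smul_right hfd hYZ]
  module

-- Read off from the Jacobi identity for `X`, `Y`, `fZ`, where `Z` is any field with `Z p ≠ 0`.
lemma SmoothNear.mvfderiv_mvfderiv_sub (hX : SmoothNear X p) (hY : SmoothNear Y p)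
    (hf : SmoothFunNear E f p) :
    mvfderiv 𝓘(ℝ, E) (fun q ↦ mvfderiv 𝓘(ℝ, E) f q (Y q)) p (X p) -
      mvfderiv 𝓘(ℝ, E) (fun q ↦ mvfderiv 𝓘(ℝ, E) f q (X q)) p (Y p) =
      mvfderiv 𝓘(ℝ, E) f p (mlieBracket 𝓘(ℝ, E) X Y p) := by
  rcases subsingleton_or_nontrivial (TangentSpace 𝓘(ℝ, E) p) with _ | _
  · simp [Subsingleton.elim (_ : TangentSpace 𝓘(ℝ, E) p) 0]
  obtain ⟨z, hz⟩ := exists_ne (0 : TangentSpace 𝓘(ℝ, E) p)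
  have hZ := SmoothNear.extend z
  have jacobi_smul := hX.jacobi hY (hZ.smul hf)
  rw [mlieBracket_mlieBracket_smul X hY hf hZ, mlieBracket_mlieBracket_smul Y hX hf hZ,
    mlieBracket_smul_right hf.mdifferentiableAt hZ.diffFieldAt, hX.jacobi hY hZ,
    FiberBundle.extend_apply_self] at jacobi_smul
  refine sub_eq_zero.1 ((smul_eq_zero.1 ?_).resolve_right hz)
  linear_combination (norm := module) jacobi_smul

end Bracket

section Curvature

variable {E : Type*} [NormedAddCommGroup E] [NormedSpace ℝ E]
  {M : Type*} [TopologicalSpace M] [ChartedSpace E M] [IsManifold 𝓘(ℝ, E) ∞ M]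
  {X Y Z W X' Y' : Π q : M, TangentSpace 𝓘(ℝ, E) q} {p : M}
  {nabla : CovariantDerivative 𝓘(ℝ, E) E (TangentSpace 𝓘(ℝ, E) : M → Type _)}
  {g : PseudoMetric E M}

variable (nabla) in
/-- The curvature of `nabla` on vector fields, `(∇_X ∇_Y Z - ∇_Y ∇_X Z - ∇_{[X, Y]} Z)(p)`;
`curvature` evaluates it on the local extensions of tangent vectors. -/
def fieldCurvature (X Y Z : Π q : M, TangentSpace 𝓘(ℝ, E) q) (p : M) : TangentSpace 𝓘(ℝ, E) p :=
  nabla (fun q ↦ nabla Z q (Y q)) p (X p) - nabla (fun q ↦ nabla Z q (X q)) p (Y p)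
    - nabla Z p (mlieBracket 𝓘(ℝ, E) X Y p)

lemma curvature_eq_fieldCurvature (x y z : TangentSpace 𝓘(ℝ, E) p) :
    curvature nabla p x y z = fieldCurvature nabla (FiberBundle.extend E x)
      (FiberBundle.extend E y) (FiberBundle.extend E z) p := by
  simp [curvature, fieldCurvature]

lemma IsLeviCivita.isSmoothConnection (hL : IsLeviCivita g nabla) : IsSmoothConnection nabla :=
  hL.smooth

lemma fieldCurvature_swap (X Y Z : Π q : M, TangentSpace 𝓘(ℝ, E) q) (p : M) :
    fieldCurvature nabla X Y Z p = -fieldCurvature nabla Y X Z p := by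
  rw [fieldCurvature, fieldCurvature, mlieBracket_swap_apply, map_neg]
  module

lemma curvature_swap (x y z : TangentSpace 𝓘(ℝ, E) p) :
    curvature nabla p x y z = -curvature nabla p y x z := by
  simpa only [curvature_eq_fieldCurvature] using fieldCurvature_swap _ _ _ _

lemma IsLeviCivita.mvfderiv_mvfderiv_form (hL : IsLeviCivita g nabla)
    (X : Π q : M, TangentSpace 𝓘(ℝ, E) q) (hY : SmoothNear Y p) (hZ : SmoothNear Z p)
    (hW : SmoothNear W p) :
    mvfderiv 𝓘(ℝ, E) (fun q ↦ mvfderiv 𝓘(ℝ, E) (fun q ↦ g.form q (Z q) (W q)) q (Y q)) p (X p) =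
      g.form p (nabla (fun q ↦ nabla Z q (Y q)) p (X p)) (W p)
        + g.form p (nabla Z p (Y p)) (nabla W p (X p))
        + (g.form p (nabla Z p (X p)) (nabla W p (Y p))
        + g.form p (Z p) (nabla (fun q ↦ nabla W q (Y q)) p (X p))) := by
  have hYZ := hY.cov hL.isSmoothConnection hZ
  have hYW := hY.cov hL.isSmoothConnection hW
  have metric : (fun q ↦ mvfderiv 𝓘(ℝ, E) (fun q ↦ g.form q (Z q) (W q)) q (Y q)) =ᶠ[𝓝 p]
      (fun q ↦ g.form q (nabla Z q (Y q)) (W q)) + fun q ↦ g.form q (Z q) (nabla W q (Y q)) := by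
    filter_upwards [hZ.eventually, hW.eventually] with q hZq hWq
    exact hL.metric _ _ _ hZq.diffFieldAt hWq.diffFieldAt _
  have metric_deriv : mvfderiv 𝓘(ℝ, E)
      (fun q ↦ mvfderiv 𝓘(ℝ, E) (fun q ↦ g.form q (Z q) (W q)) q (Y q)) p =
      mvfderiv 𝓘(ℝ, E) ((fun q ↦ g.form q (nabla Z q (Y q)) (W q)) +
        fun q ↦ g.form q (Z q) (nabla W q (Y q))) p := metric.mfderiv_eq
  rw [metric_deriv, mvfderiv_add (hYZ.form g hW).mdifferentiableAt
    (hZ.form g hYW).mdifferentiableAt, add_apply,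
    hL.metric _ _ _ hYZ.diffFieldAt hW.diffFieldAt, hL.metric _ _ _ hZ.diffFieldAt hYW.diffFieldAt]

section CompleteModel

variable [CompleteSpace E]

lemma IsLeviCivita.cov_cov_sub_cov_cov (hL : IsLeviCivita g nabla) (hX : SmoothNear X p)
    (hY : SmoothNear Y p) (hZ : SmoothNear Z p) :
    nabla (fun q ↦ nabla Y q (X q)) p (Z p) - nabla (fun q ↦ nabla X q (Y q)) p (Z p) =
      mlieBracket 𝓘(ℝ, E) Z (mlieBracket 𝓘(ℝ, E) X Y) p
        + nabla Z p (mlieBracket 𝓘(ℝ, E) X Y p) := by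
  have hYX := (hY.cov hL.isSmoothConnection hX).diffFieldAt
  have hXY := (hX.mlieBracket hY).diffFieldAt
  have torsion : ∀ᶠ q in 𝓝 p, nabla Y q (X q) =
      ((fun q ↦ nabla X q (Y q)) + mlieBracket 𝓘(ℝ, E) X Y) q := by
    filter_upwards [hX.eventually, hY.eventually] with q hXq hYq
    rw [Pi.add_apply, ← hL.torsion_free _ _ _ hXq.diffFieldAt hYq.diffFieldAt, add_sub_cancel]
  rw [DiffFieldAt.cov_congr (mdifferentiableAt_add_section hYX hXY) torsion,
    nabla.isCovariantDerivativeOnUniv.add hYX hXY, add_apply,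
    ← hL.torsion_free _ _ _ hZ.diffFieldAt hXY]
  abel

-- Torsion-freeness turns the cyclic sum of second derivatives into that of the double brackets.
lemma IsLeviCivita.fieldCurvature_bianchi (hL : IsLeviCivita g nabla) (hX : SmoothNear X p)
    (hY : SmoothNear Y p) (hZ : SmoothNear Z p) :
    fieldCurvature nabla X Y Z p + fieldCurvature nabla Y Z X p + fieldCurvature nabla Z X Y p
      = 0 := by
  have bracket_swap : mlieBracket 𝓘(ℝ, E) Y (mlieBracket 𝓘(ℝ, E) X Z) p =
      -mlieBracket 𝓘(ℝ, E) Y (mlieBracket 𝓘(ℝ, E) Z X) p := by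
    rw [mlieBracket_swap (V := X), ← neg_one_smul ℝ,
      mlieBracket_const_smul_right (hZ.mlieBracket hX).diffFieldAt, neg_one_smul]
  have jacobi := hX.jacobi hY hZ
  rw [mlieBracket_swap_apply (V := mlieBracket _ _ _), bracket_swap] at jacobi
  simp only [fieldCurvature]
  linear_combination (norm := module) hL.cov_cov_sub_cov_cov hX hY hZ +
    hL.cov_cov_sub_cov_cov hY hZ hX + hL.cov_cov_sub_cov_cov hZ hX hY + jacobi

lemma IsLeviCivita.curvature_bianchi (hL : IsLeviCivita g nabla)
    (x y z : TangentSpace 𝓘(ℝ, E) p) :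
    curvature nabla p x y z + curvature nabla p y z x + curvature nabla p z x y = 0 := by
  simpa only [curvature_eq_fieldCurvature] using
    hL.fieldCurvature_bianchi (.extend x) (.extend y) (.extend z)

lemma IsLeviCivita.form_fieldCurvature (hL : IsLeviCivita g nabla) (hX : SmoothNear X p)
    (hY : SmoothNear Y p) (hZ : SmoothNear Z p) (hW : SmoothNear W p) :
    g.form p (fieldCurvature nabla X Y Z p) (W p) =
      -g.form p (Z p) (fieldCurvature nabla X Y W p) := by
  have commutator := hX.mvfderiv_mvfderiv_sub hY (hZ.form g hW)
  rw [hL.mvfderiv_mvfderiv_form X hY hZ hW, hL.mvfderiv_mvfderiv_form Y hX hZ hW,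
    hL.metric _ _ _ hZ.diffFieldAt hW.diffFieldAt] at commutator
  simp only [fieldCurvature, map_sub, sub_apply]
  linarith

lemma IsLeviCivita.curvatureTensor_swap_right (hL : IsLeviCivita g nabla)
    (x y z u : TangentSpace 𝓘(ℝ, E) p) :
    curvatureTensor g nabla p x y z u = -curvatureTensor g nabla p x y u z := by
  rw [curvatureTensor, curvatureTensor, g.symm p _ z]
  simpa only [curvature_eq_fieldCurvature, FiberBundle.extend_apply_self] using
    hL.form_fieldCurvature (.extend x) (.extend y) (.extend z) (.extend u)

end CompleteModel

section Tensoriality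

variable [FiniteDimensional ℝ E]

lemma IsSmoothConnection.tensorialAt_fieldCurvature (hn : IsSmoothConnection nabla)
    (X : Π q : M, TangentSpace 𝓘(ℝ, E) q) (hZ : SmoothNear Z p) :
    TensorialAt 𝓘(ℝ, E) E (fun Y ↦ fieldCurvature nabla X Y Z p) p := by
  have : CompleteSpace E := FiniteDimensional.complete ℝ E
  refine ⟨fun {f Y} hf hY ↦ ?_, fun {Y W} hY hW ↦ ?_⟩
  · have hYZ := hn.diffFieldAt hY hZ
    have smul : ∀ᶠ q in 𝓝 p, nabla Z q ((f • Y) q) = (f • fun q ↦ nabla Z q (Y q)) q :=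
      .of_forall fun q ↦ by simp
    rw [fieldCurvature, DiffFieldAt.cov_congr (hf.smul_section hYZ) smul,
      nabla.isCovariantDerivativeOnUniv.leibniz hYZ hf, mlieBracket_smul_right hf hY,
      fieldCurvature]
    simp only [Pi.smul_apply', map_smul, map_add, add_apply, smul_apply,
      ContinuousLinearMap.smulRight_apply]
    module
  · have hYZ := hn.diffFieldAt hY hZ
    have hWZ := hn.diffFieldAt hW hZ
    have add : ∀ᶠ q in 𝓝 p, nabla Z q ((Y + W) q) =
        ((fun q ↦ nabla Z q (Y q)) + fun q ↦ nabla Z q (W q)) q :=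
      .of_forall fun q ↦ by simp
    rw [fieldCurvature, DiffFieldAt.cov_congr (mdifferentiableAt_add_section hYZ hWZ) add,
      nabla.isCovariantDerivativeOnUniv.add hYZ hWZ, mlieBracket_add_right hY hW,
      fieldCurvature, fieldCurvature]
    simp only [add_apply, map_add, Pi.add_apply]
    module

lemma IsSmoothConnection.fieldCurvature_congr (hn : IsSmoothConnection nabla)
    (hX : DiffFieldAt X p) (hX' : DiffFieldAt X' p) (hY : DiffFieldAt Y p)
    (hY' : DiffFieldAt Y' p) (hZ : SmoothNear Z p) (hXX' : X p = X' p) (hYY' : Y p = Y' p) :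
    fieldCurvature nabla X Y Z p = fieldCurvature nabla X' Y' Z p := by
  rw [(hn.tensorialAt_fieldCurvature X hZ).pointwise hY hY' hYY', fieldCurvature_swap,
    (hn.tensorialAt_fieldCurvature Y' hZ).pointwise hX hX' hXX', ← fieldCurvature_swap]

-- In the third slot tensoriality comes for free from the skew-symmetry and nondegeneracy of `g`.
lemma IsLeviCivita.fieldCurvature_eq_curvature (hL : IsLeviCivita g nabla) (hX : SmoothNear X p)
    (hY : SmoothNear Y p) (hZ : SmoothNear Z p) :
    fieldCurvature nabla X Y Z p = curvature nabla p (X p) (Y p) (Z p) := by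
  have : CompleteSpace E := FiniteDimensional.complete ℝ E
  have congr {V : Π q : M, TangentSpace 𝓘(ℝ, E) q} (hV : SmoothNear V p) :
      fieldCurvature nabla X Y V p = fieldCurvature nabla (FiberBundle.extend E (X p))
        (FiberBundle.extend E (Y p)) V p :=
    hL.isSmoothConnection.fieldCurvature_congr hX.diffFieldAt (SmoothNear.extend _).diffFieldAt
      hY.diffFieldAt (SmoothNear.extend _).diffFieldAt hV
      (FiberBundle.extend_apply_self _ _).symm (FiberBundle.extend_apply_self _ _).symm
  rw [curvature_eq_fieldCurvature, ← congr (.extend (Z p)), ← sub_eq_zero]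
  refine g.nondegenerate p _ fun w ↦ ?_
  have hw := SmoothNear.extend w
  have skew := hL.form_fieldCurvature hX hY hZ hw
  have skew_extend := hL.form_fieldCurvature hX hY (.extend (Z p)) hw
  rw [FiberBundle.extend_apply_self] at skew skew_extend
  rw [map_sub, sub_apply, skew, skew_extend, FiberBundle.extend_apply_self, sub_self]

lemma IsKaehler.curvature_J {h : AlmostHermitian E M} (hK : IsKaehler h nabla)
    (x y z : TangentSpace 𝓘(ℝ, E) p) :
    curvature nabla p x y (h.J p z) = h.J p (curvature nabla p x y z) := by
  have hn := hK.leviCivita.isSmoothConnection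
  have hz := SmoothNear.extend z
  have cov_cov_J (v : TangentSpace 𝓘(ℝ, E) p) : nabla (fun q ↦ nabla
      (fun q ↦ h.J q (FiberBundle.extend E z q)) q (FiberBundle.extend E v q)) p =
      nabla (fun q ↦ h.J q (nabla (FiberBundle.extend E z) q (FiberBundle.extend E v q))) p := by
    refine (((SmoothNear.extend v).cov hn hz).J h).diffFieldAt.cov_congr ?_
    filter_upwards [hz.eventually] with q hzq
    exact hK.parallel_J _ _ hzq.diffFieldAt _
  have hJz := hK.leviCivita.fieldCurvature_eq_curvature (.extend x) (.extend y) (hz.J h)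
  simp only [FiberBundle.extend_apply_self] at hJz
  rw [← hJz, fieldCurvature, cov_cov_J, cov_cov_J,
    hK.parallel_J _ _ ((SmoothNear.extend y).cov hn hz).diffFieldAt,
    hK.parallel_J _ _ ((SmoothNear.extend x).cov hn hz).diffFieldAt,
    hK.parallel_J _ _ hz.diffFieldAt, curvature_eq_fieldCurvature, fieldCurvature, map_sub,
    map_sub]

end Tensoriality

end Curvature

section Immersion

variable {E : Type*} [NormedAddCommGroup E] [NormedSpace ℝ E]
  {M : Type*} [TopologicalSpace M] [ChartedSpace E M]
  {F : Type*} [NormedAddCommGroup F] [NormedSpace ℝ F]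
  {N : Type*} [TopologicalSpace N] [ChartedSpace F N] {f : N → M} {a : N}

lemma mdifferentiable_of_mem_maximalAtlas {e : OpenPartialHomeomorph M E}
    (he : e ∈ IsManifold.maximalAtlas 𝓘(ℝ, E) ∞ M) : e.MDifferentiable 𝓘(ℝ, E) 𝓘(ℝ, E) :=
  ⟨(contMDiffOn_of_mem_maximalAtlas he).mdifferentiableOn (by simp),
    (contMDiffOn_symm_of_mem_maximalAtlas he).mdifferentiableOn (by simp)⟩

lemma exists_mfderiv_codChart_eq (hf : Manifold.IsImmersionAt 𝓘(ℝ, F) 𝓘(ℝ, E) ∞ f a) :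
    ∃ L : F →L[ℝ] E, ∀ b ∈ hf.domChart.source, ∀ u : TangentSpace 𝓘(ℝ, F) b,
      mfderiv 𝓘(ℝ, E) 𝓘(ℝ, E) hf.codChart (f b) (mfderiv 𝓘(ℝ, F) 𝓘(ℝ, E) f b u) =
        L (mfderiv 𝓘(ℝ, F) 𝓘(ℝ, F) hf.domChart b u) := by
  have hφ := mdifferentiable_of_mem_maximalAtlas hf.domChart_mem_maximalAtlas
  have hψ := mdifferentiable_of_mem_maximalAtlas hf.codChart_mem_maximalAtlas
  let L : F →L[ℝ] E := hf.equiv.toContinuousLinearMap ∘L ContinuousLinearMap.inl ℝ _ _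
  have linear_in_charts {b} (hb : b ∈ hf.domChart.source) :
      hf.codChart (f b) = L (hf.domChart b) := by
    have hb' : hf.domChart b ∈ (hf.domChart.extend 𝓘(ℝ, F)).target := by
      simpa using hf.domChart.map_source hb
    simpa [L, hf.domChart.left_inv hb] using hf.writtenInCharts hb'
  refine ⟨L, fun b hb u ↦ ?_⟩
  have hfb : MDifferentiableAt 𝓘(ℝ, F) 𝓘(ℝ, E) f b :=
    (hf.isImmersionAtOfComplement_complement.contMDiffOn.contMDiffAt
      (hf.domChart.open_source.mem_nhds hb)).mdifferentiableAt (by simp)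
  have deriv_left := (hψ.mdifferentiableAt
    (hf.source_subset_preimage_source hb)).hasMFDerivAt.comp b hfb.hasMFDerivAt
  have deriv_right := (L.hasMFDerivAt (x := hf.domChart b)).comp b
    (hφ.mdifferentiableAt hb).hasMFDerivAt
  have comp_eq : hf.codChart ∘ f =ᶠ[𝓝 b] L ∘ hf.domChart := by
    filter_upwards [hf.domChart.open_source.mem_nhds hb] with c hc using linear_in_charts hc
  exact congr($(hasMFDerivAt_unique deriv_left (deriv_right.congr_of_eventuallyEq comp_eq)) u)

lemma mpullback_const_eq_of_mfderiv_eq {e : OpenPartialHomeomorph M E}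
    (he : e ∈ IsManifold.maximalAtlas 𝓘(ℝ, E) ∞ M) {q : M} (hq : q ∈ e.source)
    {v : TangentSpace 𝓘(ℝ, E) q} {c : E} (hc : mfderiv 𝓘(ℝ, E) 𝓘(ℝ, E) e q v = c) :
    mpullback 𝓘(ℝ, E) 𝓘(ℝ, E) e (fun _ ↦ c) q = v := by
  have hde := mdifferentiable_of_mem_maximalAtlas he
  have coe_equiv : mfderiv 𝓘(ℝ, E) 𝓘(ℝ, E) e q = (hde.mfderiv hq).toContinuousLinearMap := rfl
  change (mfderiv 𝓘(ℝ, E) 𝓘(ℝ, E) e q).inverse c = v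
  rw [coe_equiv, ContinuousLinearMap.inverse_equiv, ← hc]
  exact (hde.mfderiv hq).symm_apply_apply v

variable [IsManifold 𝓘(ℝ, E) ∞ M]

lemma smoothFieldAt_mpullback_const [CompleteSpace E] {e : OpenPartialHomeomorph M E}
    (he : e ∈ IsManifold.maximalAtlas 𝓘(ℝ, E) ∞ M) (c : E) {q : M} (hq : q ∈ e.source) :
    SmoothFieldAt (mpullback 𝓘(ℝ, E) 𝓘(ℝ, E) e fun _ ↦ c) q :=
  ContMDiffAt.mpullback_vectorField_preimage (n := ∞) (m := ∞)
    (contMDiffAt_vectorSpace_iff_contDiffAt.2 contDiffAt_const)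
    (contMDiffAt_of_mem_maximalAtlas he hq)
    ⟨(mdifferentiable_of_mem_maximalAtlas he).mfderiv hq, rfl⟩ (by simp)

-- The extension has constant coordinates in a chart of `M` in which `f` is linear.
lemma exists_tangent_extension [CompleteSpace E]
    (hf : Manifold.IsImmersionAt 𝓘(ℝ, F) 𝓘(ℝ, E) ∞ f a) {v : TangentSpace 𝓘(ℝ, E) (f a)}
    (hv : v ∈ LinearMap.range (mfderiv 𝓘(ℝ, F) 𝓘(ℝ, E) f a).toLinearMap) :
    ∃ X : Π q : M, TangentSpace 𝓘(ℝ, E) q, SmoothNear X (f a) ∧ X (f a) = v ∧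
      ∀ᶠ b in 𝓝 a, X (f b) ∈ LinearMap.range (mfderiv 𝓘(ℝ, F) 𝓘(ℝ, E) f b).toLinearMap := by
  obtain ⟨w, rfl⟩ := hv
  obtain ⟨L, hL⟩ := exists_mfderiv_codChart_eq hf
  have hψ := hf.codChart_mem_maximalAtlas
  have ha := hf.mem_domChart_source
  let c : F := mfderiv 𝓘(ℝ, F) 𝓘(ℝ, F) hf.domChart a w
  refine ⟨mpullback 𝓘(ℝ, E) 𝓘(ℝ, E) hf.codChart fun _ ↦ L c, ?_, ?_, ?_⟩
  · filter_upwards [hf.codChart.open_source.mem_nhds hf.mem_codChart_source] with q hq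
    exact smoothFieldAt_mpullback_const hψ _ hq
  · exact mpullback_const_eq_of_mfderiv_eq hψ hf.mem_codChart_source (hL a ha w)
  · filter_upwards [hf.domChart.open_source.mem_nhds ha] with b hb
    obtain ⟨u, hu⟩ := (mdifferentiable_of_mem_maximalAtlas
      hf.domChart_mem_maximalAtlas).mfderiv_surjective hb c
    exact ⟨u, (mpullback_const_eq_of_mfderiv_eq hψ (hf.source_subset_preimage_source hb)
      ((hL b hb u).trans (congrArg L hu))).symm⟩

end Immersion

section TotallyGeodesic

variable {E : Type*} [NormedAddCommGroup E] [NormedSpace ℝ E]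
  {M : Type*} [TopologicalSpace M] [ChartedSpace E M] [IsManifold 𝓘(ℝ, E) ∞ M]
  {N : Type*} [TopologicalSpace N] [ChartedSpace (EuclideanSpace ℝ (Fin 2)) N]
  {f : N → M} {a : N} {X Y : Π q : M, TangentSpace 𝓘(ℝ, E) q}
  {nabla : CovariantDerivative 𝓘(ℝ, E) E (TangentSpace 𝓘(ℝ, E) : M → Type _)}
  {g : PseudoMetric E M}

lemma IsTotallyGeodesic.eventually_cov_mem (ht : IsTotallyGeodesic nabla f)
    (hf : ContinuousAt f a) (hX : SmoothNear X (f a)) (hY : SmoothNear Y (f a))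
    (tX : ∀ᶠ b in 𝓝 a, X (f b) ∈ tangentPlane f b)
    (tY : ∀ᶠ b in 𝓝 a, Y (f b) ∈ tangentPlane f b) :
    ∀ᶠ b in 𝓝 a, nabla Y (f b) (X (f b)) ∈ tangentPlane f b := by
  filter_upwards [hf.eventually hX, hf.eventually hY, eventually_eventually_nhds.2 tX,
    eventually_eventually_nhds.2 tY] with b hXb hYb tXb tYb
  exact ht b X Y hXb hYb tXb tYb

lemma IsLeviCivita.eventually_mlieBracket_mem (hL : IsLeviCivita g nabla)
    (ht : IsTotallyGeodesic nabla f) (hf : ContinuousAt f a) (hX : SmoothNear X (f a))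
    (hY : SmoothNear Y (f a)) (tX : ∀ᶠ b in 𝓝 a, X (f b) ∈ tangentPlane f b)
    (tY : ∀ᶠ b in 𝓝 a, Y (f b) ∈ tangentPlane f b) :
    ∀ᶠ b in 𝓝 a, mlieBracket 𝓘(ℝ, E) X Y (f b) ∈ tangentPlane f b := by
  filter_upwards [ht.eventually_cov_mem hf hX hY tX tY, ht.eventually_cov_mem hf hY hX tY tX,
    hf.eventually hX.eventually, hf.eventually hY.eventually] with b hXY hYX hXb hYb
  rw [← hL.torsion_free _ _ _ hXb.diffFieldAt hYb.diffFieldAt]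
  exact Submodule.sub_mem _ hXY hYX

lemma IsLeviCivita.curvature_mem_tangentPlane [FiniteDimensional ℝ E]
    (hL : IsLeviCivita g nabla) (ht : IsTotallyGeodesic nabla f)
    (hf : Manifold.IsImmersionAt (𝓡 2) 𝓘(ℝ, E) ∞ f a) {x y z : TangentSpace 𝓘(ℝ, E) (f a)}
    (hx : x ∈ tangentPlane f a) (hy : y ∈ tangentPlane f a) (hz : z ∈ tangentPlane f a) :
    curvature nabla (f a) x y z ∈ tangentPlane f a := by
  have : CompleteSpace E := FiniteDimensional.complete ℝ E
  have hn := hL.isSmoothConnection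
  have hfa : ContinuousAt f a := hf.contMDiffAt.continuousAt
  obtain ⟨X, hX, rfl, tX⟩ := exists_tangent_extension hf hx
  obtain ⟨Y, hY, rfl, tY⟩ := exists_tangent_extension hf hy
  obtain ⟨Z, hZ, rfl, tZ⟩ := exists_tangent_extension hf hz
  have hYZ := ht.eventually_cov_mem hfa hY hZ tY tZ
  have hXZ := ht.eventually_cov_mem hfa hX hZ tX tZ
  have hXY := hL.eventually_mlieBracket_mem ht hfa hX hY tX tY
  have hXYZ := ht.eventually_cov_mem hfa hX (hY.cov hn hZ) tX hYZ
  have hYXZ := ht.eventually_cov_mem hfa hY (hX.cov hn hZ) tY hXZ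
  have hXY_Z := ht.eventually_cov_mem hfa (hX.mlieBracket hY) hZ hXY tZ
  rw [← hL.fieldCurvature_eq_curvature hX hY hZ]
  exact Submodule.sub_mem _ (Submodule.sub_mem _ hXYZ.self_of_nhds hYXZ.self_of_nhds)
    hXY_Z.self_of_nhds

end TotallyGeodesic

section HermitianForms

variable {V : Type*} [AddCommGroup V] [Module ℝ V] {J : V →ₗ[ℝ] V}
  {S : LinearMap.BilinForm ℝ V}

/-- `S` is a symmetric bilinear form invariant under `J`: the real part of a Hermitian form when
`J² = -1`. -/
structure IsHermitianForm (J : V →ₗ[ℝ] V) (S : LinearMap.BilinForm ℝ V) : Prop where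
  symm (v w : V) : S v w = S w v
  J_J (v w : V) : S (J v) (J w) = S v w

lemma IsHermitianForm.smul (hS : IsHermitianForm J S) (c : ℝ) : IsHermitianForm J (c • S) where
  symm v w := by simp [hS.symm v w]
  J_J v w := by simp [hS.J_J]

section ComplexStructure

variable (hJ : ∀ v, J (J v) = -v)
include hJ

lemma IsHermitianForm.apply_J (hS : IsHermitianForm J S) (v w : V) : S v (J w) = -S w (J v) := by
  rw [← hS.J_J, hJ, map_neg, hS.symm]

lemma IsHermitianForm.apply_self_J (hS : IsHermitianForm J S) (v : V) : S v (J v) = 0 :=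
  self_eq_neg.1 (hS.apply_J hJ v v)

lemma exists_isHermitianForm_average {S₀ : LinearMap.BilinForm ℝ V}
    (hS₀ : ∀ v w, S₀ v w = S₀ w v) :
    ∃ S, IsHermitianForm J S ∧ ∀ v, S v v = (S₀ v v + S₀ (J v) (J v)) / 2 := by
  refine ⟨(1 / 2 : ℝ) • (S₀ + S₀.compl₁₂ J J), ⟨fun v w ↦ ?_, fun v w ↦ ?_⟩, fun v ↦ ?_⟩
  · simp [hS₀ v w, hS₀ (J v)]
  · simp [hJ, add_comm]
  · simp
    ring

end ComplexStructure

end HermitianForms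

section CurvatureTensors

variable {V : Type*} {T T' : V → V → V → V → ℝ}

/-- `T` has the symmetries of a Riemannian curvature tensor; by `IsAlgebraicCurvature.pair_swap`,
linearity in one argument gives linearity in all four. -/
structure IsAlgebraicCurvature [AddCommGroup V] [Module ℝ V] (T : V → V → V → V → ℝ) : Prop where
  isLinearMap (x y z : V) : IsLinearMap ℝ (T x y z)
  swap_left (x y z u : V) : T x y z u = -T y x z u
  swap_right (x y z u : V) : T x y z u = -T x y u z
  bianchi (x y z u : V) : T x y z u + T y z x u + T z x y u = 0

namespace IsAlgebraicCurvature

variable [AddCommGroup V] [Module ℝ V] (hT : IsAlgebraicCurvature T)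
include hT

-- Sum the Bianchi identity over the four choices of the fixed argument.
lemma pair_swap (x y z u : V) : T x y z u = T z u x y := by
  linarith [hT.bianchi x y z u, hT.bianchi y z u x, hT.bianchi z u x y, hT.bianchi u x y z,
    hT.swap_left x y z u, hT.swap_right x y z u, hT.swap_left z u x y, hT.swap_right z u x y,
    hT.swap_right y z x u, hT.swap_left x u y z, hT.swap_right x z u y, hT.swap_left z x u y,
    hT.swap_left z x y u, hT.swap_right z x y u, hT.swap_left u y z x, hT.swap_right u y z x,
    hT.swap_left y u z x, hT.swap_right y u z x, hT.swap_right u x y z, hT.swap_right x y u z]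

lemma add₄ (x y z u w : V) : T x y z (u + w) = T x y z u + T x y z w :=
  (hT.isLinearMap x y z).map_add u w

lemma smul₄ (c : ℝ) (x y z u : V) : T x y z (c • u) = c * T x y z u :=
  (hT.isLinearMap x y z).map_smul c u

lemma add₃ (x y z u w : V) : T x y (z + w) u = T x y z u + T x y w u := by
  rw [hT.swap_right, hT.add₄, hT.swap_right x y z, hT.swap_right x y w, neg_add]

lemma smul₃ (c : ℝ) (x y z u : V) : T x y (c • z) u = c * T x y z u := by
  rw [hT.swap_right, hT.smul₄, hT.swap_right x y z, mul_neg]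

lemma add₂ (x y z u w : V) : T x (y + w) z u = T x y z u + T x w z u := by
  rw [hT.pair_swap, hT.add₄, hT.pair_swap x y, hT.pair_swap x w]

lemma smul₂ (c : ℝ) (x y z u : V) : T x (c • y) z u = c * T x y z u := by
  rw [hT.pair_swap, hT.smul₄, hT.pair_swap x y]

lemma add₁ (x y z u w : V) : T (x + w) y z u = T x y z u + T w y z u := by
  rw [hT.pair_swap, hT.add₃, hT.pair_swap x y, hT.pair_swap w y]

lemma smul₁ (c : ℝ) (x y z u : V) : T (c • x) y z u = c * T x y z u := by
  rw [hT.pair_swap, hT.smul₃, hT.pair_swap x y]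

lemma neg₁ (x y z u : V) : T (-x) y z u = -T x y z u := by
  rw [← neg_one_smul ℝ, hT.smul₁, neg_one_mul]

lemma neg₂ (x y z u : V) : T x (-y) z u = -T x y z u := by
  rw [← neg_one_smul ℝ, hT.smul₂, neg_one_mul]

lemma neg₃ (x y z u : V) : T x y (-z) u = -T x y z u := by
  rw [← neg_one_smul ℝ, hT.smul₃, neg_one_mul]

lemma sub (hT' : IsAlgebraicCurvature T') :
    IsAlgebraicCurvature fun x y z u ↦ T x y z u - T' x y z u where
  isLinearMap x y z := ((hT.isLinearMap x y z).mk' _ - (hT'.isLinearMap x y z).mk' _).isLinear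
  swap_left x y z u := by rw [hT.swap_left, hT'.swap_left]; ring
  swap_right x y z u := by rw [hT.swap_right, hT'.swap_right]; ring
  bianchi x y z u := by linear_combination hT.bianchi x y z u - hT'.bianchi x y z u

lemma eq_zero_of_sectional (h0 : ∀ x y, T x y y x = 0) (x y z u : V) : T x y z u = 0 := by
  have polar_outer (x y z : V) : T x y y z = 0 := by
    have h := h0 (x + z) y
    have symm : T z y y x = T x y y z := by
      rw [hT.pair_swap, hT.swap_left, hT.swap_right, neg_neg]
    rw [hT.add₁, hT.add₄, hT.add₄, h0, h0, symm] at h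
    linarith
  have skew_inner (x y z u : V) : T x y z u = -T x z y u := by
    have h := polar_outer x (y + z) u
    rw [hT.add₂, hT.add₃, hT.add₃, polar_outer, polar_outer] at h
    linarith
  have cyclic (x y z u : V) : T y z x u = T x y z u := by
    rw [skew_inner, hT.swap_left, neg_neg]
  have bianchi := hT.bianchi x y z u
  rw [cyclic x y z u, ← cyclic z x y u] at bianchi
  linarith

end IsAlgebraicCurvature

end CurvatureTensors

section KaehlerTensors

variable {V : Type*} [AddCommGroup V] [Module ℝ V] {J : V →ₗ[ℝ] V}
  {T T' : V → V → V → V → ℝ}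

/-- `T` has the symmetries of the curvature tensor of a Kähler manifold. -/
structure IsKaehlerTensor (J : V →ₗ[ℝ] V) (T : V → V → V → V → ℝ) : Prop
    extends IsAlgebraicCurvature T where
  J_J_right (x y z u : V) : T x y (J z) (J u) = T x y z u

namespace IsKaehlerTensor

lemma sub (hT : IsKaehlerTensor J T) (hT' : IsKaehlerTensor J T') :
    IsKaehlerTensor J fun x y z u ↦ T x y z u - T' x y z u where
  toIsAlgebraicCurvature := hT.toIsAlgebraicCurvature.sub hT'.toIsAlgebraicCurvature
  J_J_right x y z u := by rw [hT.J_J_right, hT'.J_J_right]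

variable (hT : IsKaehlerTensor J T)
include hT

lemma J_J_left (x y z u : V) : T (J x) (J y) z u = T x y z u := by
  rw [hT.pair_swap, hT.J_J_right, hT.pair_swap]

lemma reverse_J (x y z u : V) : T x (J y) (J z) u = T u (J z) (J y) x := by
  rw [hT.pair_swap, hT.swap_left, hT.swap_right, neg_neg]

variable (hJ : ∀ v, J (J v) = -v)
include hJ

lemma swap_J_left (x y z u : V) : T x (J y) z u = T y (J x) z u := by
  rw [hT.swap_left, ← hT.J_J_left, hJ, hT.neg₁, neg_neg]

lemma swap_J_right (x y z u : V) : T x y (J z) u = T x y (J u) z := by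
  rw [hT.pair_swap, hT.pair_swap x, hT.swap_left, hT.swap_J_left hJ, ← hT.swap_left]

lemma holomorphic_smul_add (t : ℝ) (v w : V) :
    T (t • v + w) (J (t • v + w)) (J (t • v + w)) (t • v + w) =
      t ^ 4 * T v (J v) (J v) v + t ^ 3 * (4 * T v (J v) (J v) w)
        + t ^ 2 * (2 * T v (J v) (J w) w + 4 * T v (J w) (J v) w)
        + t * (4 * T v (J w) (J w) w) + T w (J w) (J w) w := by
  have left := hT.swap_J_left hJ
  have right := hT.swap_J_right hJ
  have reverse := hT.reverse_J
  simp only [map_add, map_smul, hT.add₁, hT.add₂, hT.add₃, hT.add₄, hT.smul₁, hT.smul₂, hT.smul₃,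
    hT.smul₄]
  linear_combination
    t ^ 3 * (right v (J v) w v + left v w (J v) v + 2 * reverse w v v v)
      + t ^ 2 * (reverse w w v v + right v (J w) w v + left w v (J v) w + left w v (J w) v
        + right v (J w) w v)
      + t * (left w v (J w) w + right w (J w) v w + 2 * reverse w w w v)

-- Polarization gives `K(v, w) + 3 K(v, J w) = 0` for `K(v, w) = T(v, w, w, v)`; now replace `w` by
-- `J w`.
lemma eq_zero_of_holomorphic (h0 : ∀ v, T v (J v) (J v) v = 0) (x y z u : V) : T x y z u = 0 := by
  have polar (v w : V) : T v (J v) (J w) w + 2 * T v (J w) (J v) w = 0 := by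
    have pos := hT.holomorphic_smul_add hJ 1 v w
    have neg := hT.holomorphic_smul_add hJ (-1) v w
    simp only [h0] at pos neg
    linarith
  have bianchi (v w : V) : T v (J v) (J w) w = T v w w v + T v (J w) (J w) v := by
    linarith [hT.bianchi v (J v) (J w) w, hT.J_J_left v w v w, hT.swap_right v w v w,
      hT.swap_left (J w) v (J v) w, hT.swap_J_right hJ v (J w) v w]
  have sectional (v w : V) : 3 * T v (J w) (J w) v + T v w w v = 0 := by
    linarith [polar v w, bianchi v w, hT.swap_J_right hJ v (J w) v w]
  refine hT.eq_zero_of_sectional (fun v w ↦ ?_) x y z u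
  have sectional_J := sectional v (J w)
  rw [hJ, hT.neg₂, hT.neg₃] at sectional_J
  linarith [sectional v w]

end IsKaehlerTensor

end KaehlerTensors

section Division

lemma eq_zero_of_analyticAt_of_eventually_atTop {F : ℝ → ℝ} (hF : ∀ s, AnalyticAt ℝ F s)
    (h0 : ∀ᶠ s in Filter.atTop, F s = 0) (s : ℝ) : F s = 0 := by
  obtain ⟨s₀, hs₀⟩ := Filter.eventually_atTop.1 h0
  have zero_near : F =ᶠ[𝓝 (s₀ + 1)] 0 := by
    filter_upwards [lt_mem_nhds (lt_add_one s₀)] with t ht using hs₀ t ht.le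
  exact AnalyticOnNhd.eqOn_zero_of_preconnected_of_eventuallyEq_zero (U := Set.univ)
    (fun t _ ↦ hF t) isPreconnected_univ (Set.mem_univ _) zero_near (Set.mem_univ s)

lemma eventually_atTop_quadratic_pos (a b : ℝ) :
    ∀ᶠ s : ℝ in Filter.atTop, 0 < a + 2 * s * b + s ^ 2 := by
  filter_upwards [Filter.eventually_gt_atTop (1 + |a| + 2 * |b|)] with s hs
  nlinarith [neg_abs_le a, neg_abs_le b, abs_nonneg a, abs_nonneg b]

variable {V : Type*} [AddCommGroup V] [Module ℝ V] {J : V →ₗ[ℝ] V} {g : LinearMap.BilinForm ℝ V}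
  {T : V → V → V → V → ℝ} {e : V}

/-- The projection along `e` onto its `g`-orthogonal complement, for a vector `e` with
`g e e = -1`. -/
def orthogonalPart (g : LinearMap.BilinForm ℝ V) (e : V) : V →ₗ[ℝ] V :=
  LinearMap.id + (g e).smulRight e

lemma orthogonalPart_apply (v : V) : orthogonalPart g e v = v + g e v • e := rfl

lemma neg_smul_add_orthogonalPart (v : V) : (-g e v) • e + orthogonalPart g e v = v := by
  rw [orthogonalPart_apply]
  module

lemma apply_orthogonalPart (he : g e e = -1) (v : V) : g e (orthogonalPart g e v) = 0 := by
  simp [orthogonalPart_apply, he]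

lemma apply_self_eq_orthogonalPart (hg : ∀ v w, g v w = g w v) (he : g e e = -1) (v : V) :
    g v v = g (orthogonalPart g e v) (orthogonalPart g e v) - g e v ^ 2 := by
  simp only [orthogonalPart_apply, map_add, map_smul, LinearMap.add_apply, LinearMap.smul_apply,
    smul_eq_mul, he, hg v e]
  ring

variable (J g T e) in
/-- The bilinear form whose values on the diagonal are the quotient of the holomorphic sectional
curvature of `T` by `g` if the former vanishes on isotropic vectors and `g e e = -1`; see
`IsKaehlerTensor.holomorphic_eq_mul`. It results from eliminating the terms of degree 3 and 4 in the
orthogonal part `P v` from the expansion of the curvature of `v = -g(e, v) e + P v`. -/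
def holomorphicQuotient (v w : V) : ℝ :=
  let P := orthogonalPart g e
  2 * (g e v * T e (J e) (J e) (P w) + g e w * T e (J e) (J e) (P v))
    - T e (J e) (J e) e * (g e v * g e w + g (P v) (P w))
    - (2 * T e (J e) (J (P v)) (P w) + 4 * T e (J (P v)) (J e) (P w))

namespace IsKaehlerTensor

-- The vectors `± √(g w w) • e + w` are isotropic.
lemma holomorphic_relations_of_isotropic (hT : IsKaehlerTensor J T) (hJ : ∀ v, J (J v) = -v)
    (hg : ∀ v w, g v w = g w v) (h0 : ∀ v, g v v = 0 → T v (J v) (J v) v = 0) (he : g e e = -1)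
    {w : V} (hew : g e w = 0) (hw : 0 < g w w) :
    T e (J e) (J e) w * g w w + T e (J w) (J w) w = 0 ∧
      T e (J e) (J e) e * g w w ^ 2
        + (2 * T e (J e) (J w) w + 4 * T e (J w) (J e) w) * g w w + T w (J w) (J w) w = 0 := by
  obtain ⟨r, hr, hrw⟩ : ∃ r : ℝ, r ≠ 0 ∧ r ^ 2 = g w w :=
    ⟨√(g w w), (Real.sqrt_pos.2 hw).ne', Real.sq_sqrt hw.le⟩
  have expansion {t : ℝ} (ht : t ^ 2 = g w w) := by
    have isotropic : g (t • e + w) (t • e + w) = 0 := by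
      simp only [map_add, map_smul, LinearMap.add_apply, LinearMap.smul_apply, smul_eq_mul, he,
        hew, hg w e]
      linear_combination -ht
    exact (hT.holomorphic_smul_add hJ t e w).symm.trans (h0 _ isotropic)
  have pos := expansion hrw
  have neg := expansion ((neg_sq r).trans hrw)
  rw [← hrw]
  refine ⟨mul_left_cancel₀ hr ?_, ?_⟩ <;> linarith

lemma isBilinearMap_holomorphicQuotient (hT : IsKaehlerTensor J T) :
    IsBilinearMap ℝ (holomorphicQuotient J g T e) := by
  constructor <;> intros <;>
    simp only [holomorphicQuotient, map_add, map_smul, LinearMap.add_apply, LinearMap.smul_apply,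
      smul_eq_mul, hT.add₂, hT.add₃, hT.add₄, hT.smul₂, hT.smul₃, hT.smul₄] <;>
    ring

lemma holomorphicQuotient_comm (hT : IsKaehlerTensor J T) (hJ : ∀ v, J (J v) = -v)
    (hg : ∀ v w, g v w = g w v) (v w : V) :
    holomorphicQuotient J g T e v w = holomorphicQuotient J g T e w v := by
  have comm_right (x y : V) := hT.swap_J_right hJ e (J e) x y
  have comm_middle (x y : V) : T e (J x) (J e) y = T e (J y) (J e) x := by
    rw [hT.reverse_J, hT.swap_J_left hJ, hT.swap_J_right hJ]
  simp only [holomorphicQuotient]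
  rw [comm_right (orthogonalPart g e v), comm_middle (orthogonalPart g e v),
    hg (orthogonalPart g e v)]
  ring

lemma holomorphic_eq_mul_of_pos (hT : IsKaehlerTensor J T) (hJ : ∀ v, J (J v) = -v)
    (hg : ∀ v w, g v w = g w v) (h0 : ∀ v, g v v = 0 → T v (J v) (J v) v = 0) (he : g e e = -1)
    {v : V} (hv : 0 < g (orthogonalPart g e v) (orthogonalPart g e v)) :
    T v (J v) (J v) v = g v v * holomorphicQuotient J g T e v v := by
  obtain ⟨odd, even⟩ :=
    hT.holomorphic_relations_of_isotropic hJ hg h0 he (apply_orthogonalPart he v) hv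
  have expansion := hT.holomorphic_smul_add hJ (-g e v) e (orthogonalPart g e v)
  rw [neg_smul_add_orthogonalPart] at expansion
  rw [expansion, apply_self_eq_orthogonalPart hg he, holomorphicQuotient]
  linear_combination (-4 * g e v) * odd + even

lemma analyticAt_holomorphic_line (hT : IsKaehlerTensor J T) (v y : V) (s : ℝ) :
    AnalyticAt ℝ (fun s : ℝ ↦ T (v + s • y) (J (v + s • y)) (J (v + s • y)) (v + s • y)) s := by
  simp only [map_add, map_smul, hT.add₁, hT.add₂, hT.add₃, hT.add₄, hT.smul₁, hT.smul₂, hT.smul₃,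
    hT.smul₄]
  fun_prop

lemma holomorphic_eq_mul (hT : IsKaehlerTensor J T) (hJ : ∀ v, J (J v) = -v)
    (hg : ∀ v w, g v w = g w v) (h0 : ∀ v, g v v = 0 → T v (J v) (J v) v = 0) (he : g e e = -1)
    {y : V} (hy : g y y = 1) (hey : g e y = 0) (v : V) :
    T v (J v) (J v) v = g v v * holomorphicQuotient J g T e v v := by
  let F (s : ℝ) := T (v + s • y) (J (v + s • y)) (J (v + s • y)) (v + s • y)
    - g (v + s • y) (v + s • y) * holomorphicQuotient J g T e (v + s • y) (v + s • y)
  have analytic (s : ℝ) : AnalyticAt ℝ F s := by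
    refine (hT.analyticAt_holomorphic_line v y s).sub ?_
    have hB := hT.isBilinearMap_holomorphicQuotient (g := g) (e := e)
    simp only [map_add, map_smul, LinearMap.add_apply, LinearMap.smul_apply, hB.add_left,
      hB.add_right, hB.smul_left, hB.smul_right]
    fun_prop
  have zero_atTop : ∀ᶠ s in Filter.atTop, F s = 0 := by
    filter_upwards [eventually_atTop_quadratic_pos
      (g (orthogonalPart g e v) (orthogonalPart g e v)) (g (orthogonalPart g e v) y)] with s hs
    refine sub_eq_zero.2 (hT.holomorphic_eq_mul_of_pos hJ hg h0 he ?_)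
    have hPy : orthogonalPart g e y = y := by simp [orthogonalPart_apply, hey]
    simp only [map_add, map_smul, LinearMap.add_apply, LinearMap.smul_apply, smul_eq_mul, hPy, hy,
      hg y]
    linarith
  simpa [F, sub_eq_zero] using eq_zero_of_analyticAt_of_eventually_atTop analytic zero_atTop 0

lemma exists_isHermitianForm_holomorphic_eq_mul (hT : IsKaehlerTensor J T)
    (hJ : ∀ v, J (J v) = -v) (hg : IsHermitianForm J g)
    (h0 : ∀ v, g v v = 0 → T v (J v) (J v) v = 0) (he : g e e = -1) {y : V} (hy : g y y = 1)
    (hey : g e y = 0) :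
    ∃ S, IsHermitianForm J S ∧ ∀ v, T v (J v) (J v) v = g v v * S v v := by
  have hB := hT.isBilinearMap_holomorphicQuotient (g := g) (e := e)
  obtain ⟨S, hS, average⟩ := exists_isHermitianForm_average hJ (S₀ := hB.toLinearMap)
    (hT.holomorphicQuotient_comm hJ hg.symm)
  have quotient := hT.holomorphic_eq_mul hJ hg.symm h0 he hy hey
  refine ⟨S, hS, fun v ↦ ?_⟩
  have quotient_J := quotient (J v)
  rw [hT.J_J_left, hT.J_J_right, hg.J_J] at quotient_J
  have average_v : S v v = (holomorphicQuotient J g T e v v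
    + holomorphicQuotient J g T e (J v) (J v)) / 2 := average v
  rw [average_v]
  linarith [quotient v]

end IsKaehlerTensor

end Division

section BochnerTensor

variable {V : Type*} [AddCommGroup V] [Module ℝ V] {J : V →ₗ[ℝ] V}
  {g S : LinearMap.BilinForm ℝ V} {T : V → V → V → V → ℝ}

/-- The tensor `φ(S) + ψ(S)`, a Kähler tensor when `g` and `S` are Hermitian. -/
def phiAddPsi (g : LinearMap.BilinForm ℝ V) (J : V →ₗ[ℝ] V) (S : LinearMap.BilinForm ℝ V)
    (x y z u : V) : ℝ :=
  phi (fun v w ↦ g v w) (fun v w ↦ S v w) x y z u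
    + psi (fun v w ↦ g v w) J (fun v w ↦ S v w) x y z u

lemma isKaehlerTensor_phiAddPsi (hJ : ∀ v, J (J v) = -v) (hg : IsHermitianForm J g)
    (hS : IsHermitianForm J S) :
    IsKaehlerTensor J (phiAddPsi g J S) where
  isLinearMap x y z := by
    constructor <;> intros <;>
      simp only [phiAddPsi, phi, psi, map_add, map_smul, smul_eq_mul] <;>
      ring
  swap_left x y z u := by
    simp only [phiAddPsi, phi, psi]
    rw [hg.apply_J hJ y x, hS.apply_J hJ y x]
    ring
  swap_right x y z u := by
    simp only [phiAddPsi, phi, psi]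
    rw [hg.apply_J hJ u z, hS.apply_J hJ u z]
    ring
  bianchi x y z u := by
    simp only [phiAddPsi, phi, psi]
    rw [hg.symm y x, hg.symm z x, hg.symm z y, hS.symm y x, hS.symm z x, hS.symm z y,
      hg.apply_J hJ y x, hg.apply_J hJ z x, hg.apply_J hJ z y, hS.apply_J hJ y x,
      hS.apply_J hJ z x, hS.apply_J hJ z y]
    ring
  J_J_right x y z u := by
    simp only [phiAddPsi, phi, psi, hJ, map_neg]
    rw [hg.symm (J z) u, hS.symm (J z) u, hg.apply_J hJ u z, hS.apply_J hJ u z]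
    ring

lemma phiAddPsi_holomorphic (hJ : ∀ v, J (J v) = -v) (hg : IsHermitianForm J g)
    (hS : IsHermitianForm J S) (v : V) :
    phiAddPsi g J S v (J v) (J v) v = 8 * (g v v * S v v) := by
  simp only [phiAddPsi, phi, psi, hJ, map_neg, hg.J_J, hS.J_J, hg.symm (J v) v, hS.symm (J v) v,
    hg.apply_self_J hJ, hS.apply_self_J hJ]
  ring

variable {ι : Type*}

/-- The family `e` is orthonormal for the possibly indefinite form `g`. -/
structure IsOrthonormal (g : LinearMap.BilinForm ℝ V) (e : ι → V) : Prop where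
  apply_self (i : ι) : g (e i) (e i) = 1 ∨ g (e i) (e i) = -1
  apply_of_ne (i j : ι) (hij : i ≠ j) : g (e i) (e j) = 0

lemma IsOrthonormal.apply_self_mul_self {e : ι → V} (he : IsOrthonormal g e) (i : ι) :
    g (e i) (e i) * g (e i) (e i) = 1 :=
  mul_self_eq_one_iff.2 (he.apply_self i)

variable {e : Module.Basis ι ℝ V}

lemma IsOrthonormal.apply_left (he : IsOrthonormal g e) (i : ι) (a : V) :
    g (e i) a = g (e i) (e i) * e.repr a i := by
  suffices coordinate : g (e i) = g (e i) (e i) • e.coord i from congr($coordinate a)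
  refine e.ext fun j ↦ ?_
  rcases eq_or_ne i j with rfl | hij
  · simp
  · simp [he.apply_of_ne i j hij, Finsupp.single_eq_of_ne hij]

variable [Fintype ι]

namespace IsOrthonormal

variable (he : IsOrthonormal g e)
include he

lemma sum_apply_mul (f : V →ₗ[ℝ] ℝ) (a : V) :
    ∑ i, g (e i) (e i) * (g (e i) a * f (e i)) = f a := by
  conv_rhs => rw [← e.sum_repr a, map_sum]
  refine Finset.sum_congr rfl fun i _ ↦ ?_
  rw [he.apply_left i a, map_smul, smul_eq_mul]
  linear_combination e.repr a i * f (e i) * he.apply_self_mul_self i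

lemma trace_self : trace (fun v w ↦ g v w) e (fun v w ↦ g v w) = Fintype.card ι := by
  simp [trace, he.apply_self_mul_self]

lemma ricci_phi (hg : ∀ v w, g v w = g w v) (hS : ∀ v w, S v w = S w v) (y z : V) :
    ricci (fun v w ↦ g v w) e (phi (fun v w ↦ g v w) (fun v w ↦ S v w)) y z =
      trace (fun v w ↦ g v w) e (fun v w ↦ S v w) * g y z + (Fintype.card ι - 2) * S y z := by
  have summand (i : ι) :
      g (e i) (e i) * phi (fun v w ↦ g v w) (fun v w ↦ S v w) (e i) y z (e i) =
        g (e i) (e i) * S (e i) (e i) * g y z - g (e i) (e i) * (g (e i) z * S y (e i))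
          + g (e i) (e i) * g (e i) (e i) * S y z
          - g (e i) (e i) * (g (e i) y * S z (e i)) := by
    simp only [phi, hg y (e i), hS (e i) z]
    ring
  have trace_g := he.trace_self
  simp only [trace] at trace_g
  simp only [ricci, trace, summand, Finset.sum_add_distrib, Finset.sum_sub_distrib,
    ← Finset.sum_mul, he.sum_apply_mul, trace_g, hS z y]
  ring

lemma ricci_psi (hJ : ∀ v, J (J v) = -v) (hg : IsHermitianForm J g) (hS : IsHermitianForm J S)
    (y z : V) :
    ricci (fun v w ↦ g v w) e (psi (fun v w ↦ g v w) J (fun v w ↦ S v w)) y z = 6 * S y z := by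
  have summand (i : ι) :
      g (e i) (e i) * psi (fun v w ↦ g v w) J (fun v w ↦ S v w) (e i) y z (e i) =
        3 * (g (e i) (e i) * (g (e i) (J z) * S (J y) (e i)))
          + 3 * (g (e i) (e i) * (g (e i) (J y) * S (J z) (e i))) := by
    simp only [psi, hg.apply_self_J hJ, hS.apply_self_J hJ, hg.apply_J hJ y (e i),
      hg.apply_J hJ z (e i), hS.apply_J hJ y (e i), hS.apply_J hJ z (e i), hS.symm (J y),
      hS.symm (J z)]
    ring
  simp only [ricci, summand, Finset.sum_add_distrib, ← Finset.mul_sum, he.sum_apply_mul, hS.J_J,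
    hS.symm z y]
  ring

lemma ricci_phiAddPsi (hJ : ∀ v, J (J v) = -v) (hg : IsHermitianForm J g)
    (hS : IsHermitianForm J S) (y z : V) :
    ricci (fun v w ↦ g v w) e (phiAddPsi g J S) y z =
      trace (fun v w ↦ g v w) e (fun v w ↦ S v w) * g y z + (Fintype.card ι + 4) * S y z := by
  have phi_part := he.ricci_phi hg.symm hS.symm y z
  have psi_part := he.ricci_psi hJ hg hS y z
  simp only [ricci] at phi_part psi_part ⊢
  simp only [phiAddPsi, mul_add, Finset.sum_add_distrib, phi_part, psi_part]
  ring

lemma trace_ricci_phiAddPsi (hJ : ∀ v, J (J v) = -v) (hg : IsHermitianForm J g)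
    (hS : IsHermitianForm J S) :
    trace (fun v w ↦ g v w) e (ricci (fun v w ↦ g v w) e (phiAddPsi g J S)) =
      2 * (Fintype.card ι + 2) * trace (fun v w ↦ g v w) e (fun v w ↦ S v w) := by
  have trace_g := he.trace_self
  simp only [trace] at trace_g
  have summand (i : ι) (c d : ℝ) : g (e i) (e i) * (c * g (e i) (e i) + d * S (e i) (e i)) =
      c * (g (e i) (e i) * g (e i) (e i)) + d * (g (e i) (e i) * S (e i) (e i)) := by
    ring
  simp only [trace, he.ricci_phiAddPsi hJ hg hS, summand, Finset.sum_add_distrib,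
    ← Finset.mul_sum, trace_g]
  ring

end IsOrthonormal

-- The coefficients with denominators `n - 1` and `n - 2`, which are junk for small `n`, multiply
-- tensors that vanish for a Kähler tensor.
lemma IsKaehlerTensor.bochner_eq (hT : IsKaehlerTensor J T) (n : ℕ) (x y z u : V) :
    bochner n (fun v w ↦ g v w) J e T x y z u =
      T x y z u
        - 1 / (2 * ((n : ℝ) + 2)) *
          (phi (fun v w ↦ g v w) (ricci (fun v w ↦ g v w) e T) x y z u
            + psi (fun v w ↦ g v w) J (ricci (fun v w ↦ g v w) e T) x y z u)
        + 1 / (4 * ((n : ℝ) + 1) * ((n : ℝ) + 2)) *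
          trace (fun v w ↦ g v w) e (ricci (fun v w ↦ g v w) e T) *
          (pi₁ (fun v w ↦ g v w) x y z u + pi₂ (fun v w ↦ g v w) J x y z u) := by
  have bar (x y z u : V) : T (J x) (J y) (J z) (J u) = T x y z u := by
    rw [hT.J_J_right, hT.J_J_left]
  have ricciStar_eq : ricciStar (fun v w ↦ g v w) J e T = ricci (fun v w ↦ g v w) e T := by
    simp only [funext_iff, ricciStar, ricci, hT.J_J_right, implies_true]
  have ricci_double (y z : V) : ricci (fun v w ↦ g v w) e (fun x y z u ↦ T x y z u + T x y z u) y z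
      = 2 * ricci (fun v w ↦ g v w) e T y z := by
    simp only [ricci, mul_add, Finset.sum_add_distrib, two_mul]
  have ricciStar_double (y z : V) :
      ricciStar (fun v w ↦ g v w) J e (fun x y z u ↦ T x y z u + T x y z u) y z
        = 2 * ricci (fun v w ↦ g v w) e T y z := by
    simp only [← ricciStar_eq, ricciStar, mul_add, Finset.sum_add_distrib, two_mul]
  have ricci_zero : ricci (fun v w ↦ g v w) e (fun _ _ _ _ ↦ 0) = fun _ _ ↦ 0 := by
    simp [funext_iff, ricci]
  have ricciStar_zero : ricciStar (fun v w ↦ g v w) J e (fun _ _ _ _ ↦ 0) = fun _ _ ↦ 0 := by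
    simp [funext_iff, ricciStar]
  simp only [bochner, bar, sub_self, ricci_double, ricciStar_double, ricci_zero, ricciStar_zero,
    ricciStar_eq, phi, psi]
  field_simp
  ring

lemma bochner_phiAddPsi (he : IsOrthonormal g e) {n : ℕ} (hn : Fintype.card ι = 2 * n)
    (hJ : ∀ v, J (J v) = -v) (hg : IsHermitianForm J g) (hS : IsHermitianForm J S)
    (x y z u : V) :
    bochner n (fun v w ↦ g v w) J e (phiAddPsi g J S) x y z u = 0 := by
  have hn' : (Fintype.card ι : ℝ) = 2 * n := by exact_mod_cast hn
  rw [(isKaehlerTensor_phiAddPsi hJ hg hS).bochner_eq, he.trace_ricci_phiAddPsi hJ hg hS,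
    funext₂ (he.ricci_phiAddPsi hJ hg hS), hn']
  simp only [phiAddPsi, phi, psi, pi₁, pi₂]
  field_simp
  ring

lemma IsKaehlerTensor.bochner_eq_zero (hT : IsKaehlerTensor J T) (he : IsOrthonormal g e)
    {n : ℕ} (hn : Fintype.card ι = 2 * n) (hJ : ∀ v, J (J v) = -v) (hg : IsHermitianForm J g)
    {a b : V} (ha : g a a = -1) (hb : g b b = 1) (hab : g a b = 0)
    (h0 : ∀ v, g v v = 0 → T v (J v) (J v) v = 0) (x y z u : V) :
    bochner n (fun v w ↦ g v w) J e T x y z u = 0 := by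
  obtain ⟨S, hS, holomorphic⟩ :=
    hT.exists_isHermitianForm_holomorphic_eq_mul hJ hg h0 ha hb hab
  have hS8 := hS.smul (1 / 8)
  have hφψ := isKaehlerTensor_phiAddPsi hJ hg hS8
  have holomorphic_sub (v : V) : T v (J v) (J v) v
      - phiAddPsi g J ((1 / 8 : ℝ) • S) v (J v) (J v) v = 0 := by
    rw [phiAddPsi_holomorphic hJ hg hS8, holomorphic]
    simp only [LinearMap.smul_apply, smul_eq_mul]
    ring
  obtain rfl : T = phiAddPsi g J ((1 / 8 : ℝ) • S) := by
    ext x y z u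
    exact sub_eq_zero.1 ((hT.sub hφψ).eq_zero_of_holomorphic hJ holomorphic_sub x y z u)
  exact bochner_phiAddPsi he hn hJ hg hS8 x y z u

end BochnerTensor

section IsotropicPlanes

variable {E : Type*} [NormedAddCommGroup E] [NormedSpace ℝ E]
  {M : Type*} [TopologicalSpace M] [ChartedSpace E M] [IsManifold 𝓘(ℝ, E) ∞ M]
  {nabla : CovariantDerivative 𝓘(ℝ, E) E (TangentSpace 𝓘(ℝ, E) : M → Type _)}
  {h : AlmostHermitian E M}

/-- The metric at `p` as a bilinear form in the sense of linear algebra. -/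
def PseudoMetric.bilinForm (g : PseudoMetric E M) (p : M) :
    LinearMap.BilinForm ℝ (TangentSpace 𝓘(ℝ, E) p) :=
  (g.form p).toLinearMap₁₂

lemma AlmostHermitian.isHermitianForm (h : AlmostHermitian E M) (p : M) :
    IsHermitianForm (h.J p).toLinearMap (h.g.bilinForm p) where
  symm := h.g.symm p
  J_J := h.compat p

lemma AlmostHermitian.form_self_J (h : AlmostHermitian E M) (p : M)
    (v : TangentSpace 𝓘(ℝ, E) p) : h.g.form p v (h.J p v) = 0 :=
  (h.isHermitianForm p).apply_self_J (h.J_sq p) v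

lemma AlmostHermitian.linearIndependent_J (h : AlmostHermitian E M) {p : M}
    {v : TangentSpace 𝓘(ℝ, E) p} (hv : v ≠ 0) : LinearIndependent ℝ ![v, h.J p v] := by
  rw [LinearIndependent.pair_iff]
  intro s t hst
  have hJst := congrArg (h.J p) hst
  simp only [map_add, map_smul, h.J_sq, map_zero] at hJst
  have sq_smul : (s ^ 2 + t ^ 2) • v = 0 := by
    linear_combination (norm := module) s • hst - t • hJst
  have sq_add_sq := (smul_eq_zero.1 sq_smul).resolve_right hv
  constructor <;> nlinarith

lemma AlmostHermitian.map_J_span (h : AlmostHermitian E M) (p : M)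
    (v : TangentSpace 𝓘(ℝ, E) p) :
    (Submodule.span ℝ {v, h.J p v}).map (h.J p).toLinearMap = Submodule.span ℝ {v, h.J p v} := by
  have J_image : (h.J p).toLinearMap '' {v, h.J p v} = {h.J p v, -v} := by
    simp [Set.image_pair, h.J_sq]
  rw [Submodule.map_span, J_image, Submodule.span_insert, ← Set.neg_singleton,
    Submodule.span_neg, sup_comm, ← Submodule.span_insert]

lemma isIsotropicHolomorphicPlane_span {p : M} {v : TangentSpace 𝓘(ℝ, E) p} (hv : v ≠ 0)
    (hvv : h.g.form p v v = 0) :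
    IsIsotropicHolomorphicPlane h p (Submodule.span ℝ {v, h.J p v}) := by
  refine ⟨?_, h.map_J_span p v, v, Submodule.subset_span (by simp), hv, fun w hw ↦ ?_⟩
  · have finrank_eq := finrank_span_eq_card (h.linearIndependent_J hv)
    rwa [Matrix.range_cons_cons_empty, Fintype.card_fin] at finrank_eq
  · obtain ⟨s, t, rfl⟩ := Submodule.mem_span_pair.1 hw
    simp [hvv, h.form_self_J]

lemma AxiomOfIsotropicHolomorphicPlanes.curvatureTensor_eq_zero [FiniteDimensional ℝ E]
    (hax : AxiomOfIsotropicHolomorphicPlanes h nabla) (hL : IsLeviCivita h.g nabla) {p : M}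
    {v : TangentSpace 𝓘(ℝ, E) p} (hvv : h.g.form p v v = 0) :
    curvatureTensor h.g nabla p v (h.J p v) (h.J p v) v = 0 := by
  rcases eq_or_ne v 0 with rfl | hv
  · simp [curvatureTensor]
  obtain ⟨N, _, _, _, f, a, rfl, hf, -, tangent, -, ht⟩ :=
    hax p _ (isIsotropicHolomorphicPlane_span hv hvv)
  replace tangent : tangentPlane f a = Submodule.span ℝ {v, h.J (f a) v} := tangent
  have v_mem : v ∈ tangentPlane f a := tangent ▸ Submodule.subset_span (by simp)
  have Jv_mem : h.J (f a) v ∈ tangentPlane f a := tangent ▸ Submodule.subset_span (by simp)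
  have curvature_mem := hL.curvature_mem_tangentPlane ht (hf.isImmersionAt a) v_mem Jv_mem Jv_mem
  obtain ⟨s, t, hst⟩ := Submodule.mem_span_pair.1 (tangent ▸ curvature_mem)
  rw [curvatureTensor, ← hst, h.g.symm]
  simp [hvv, h.form_self_J]

lemma IsKaehler.isKaehlerTensor_curvatureTensor [FiniteDimensional ℝ E] (hK : IsKaehler h nabla)
    (p : M) : IsKaehlerTensor (h.J p).toLinearMap (curvatureTensor h.g nabla p) := by
  have : CompleteSpace E := FiniteDimensional.complete ℝ E
  refine ⟨⟨fun x y z ↦ (h.g.form p (curvature nabla p x y z)).isLinear, fun x y z u ↦ ?_,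
    hK.leviCivita.curvatureTensor_swap_right, fun x y z u ↦ ?_⟩, fun x y z u ↦ ?_⟩
  · simp [curvatureTensor, curvature_swap x y z]
  · simpa [curvatureTensor] using
      congr(h.g.form p $(hK.leviCivita.curvature_bianchi x y z) u)
  · simpa [curvatureTensor, hK.curvature_J x y z] using h.compat p _ u

end IsotropicPlanes

end IndefKaehler

end

theorem theorem10_general {E : Type*} [NormedAddCommGroup E] [NormedSpace ℝ E]
    {M : Type*} [TopologicalSpace M] [ChartedSpace E M] [IsManifold 𝓘(ℝ, E) ∞ M]
    (n s : ℕ) (hs : 1 ≤ s) (hns : 1 ≤ n - s)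
    (h : IndefKaehler.AlmostHermitian E M)
    (hsig : h.g.HasSignature (2 * s) (2 * (n - s)))
    (nabla : CovariantDerivative 𝓘(ℝ, E) E (TangentSpace 𝓘(ℝ, E) : M → Type _))
    (hK : IndefKaehler.IsKaehler h nabla)
    (hax : IndefKaehler.AxiomOfIsotropicHolomorphicPlanes h nabla) :
    IndefKaehler.BochnerVanishes n h nabla := by
  intro p e he x y z u
  obtain ⟨b, hb, negative, positive⟩ := hsig p
  have : FiniteDimensional ℝ E := Module.Finite.of_basis b
  exact (hK.isKaehlerTensor_curvatureTensor p).bochner_eq_zero (g := h.g.bilinForm p)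
    ⟨he.1, he.2⟩ (Fintype.card_fin _) (h.J_sq p) (h.isHermitianForm p)
    (negative ⟨0, by lia⟩) (positive ⟨0, by lia⟩) (hb.2 _ _ Sum.inl_ne_inr)
    (fun v hv ↦ hax.curvatureTensor_eq_zero hK.leviCivita hv) x y z u

theorem theorem10 {E : Type*} [NormedAddCommGroup E] [NormedSpace ℝ E] [FiniteDimensional ℝ E]
    {M : Type*} [TopologicalSpace M] [T2Space M] [ChartedSpace E M] [IsManifold 𝓘(ℝ, E) ∞ M]
    (n s : ℕ) (hs : 2 ≤ s) (hns : 2 ≤ n - s)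
    (h : IndefKaehler.AlmostHermitian E M)
    (hsig : h.g.HasSignature (2 * s) (2 * (n - s)))
    (nabla : CovariantDerivative 𝓘(ℝ, E) E (TangentSpace 𝓘(ℝ, E) : M → Type _))
    (hK : IndefKaehler.IsKaehler h nabla)
    (hax : IndefKaehler.AxiomOfIsotropicHolomorphicPlanes h nabla) :
    IndefKaehler.BochnerVanishes n h nabla :=
  theorem10_general n s (by lia) (by lia) h hsig nabla hK hax
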